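/- All manifolds, metrics, tensors and vector fields are smooth ($C^\infty$). Let $M=\prod_{i=1}^{k} M_i$ be a connected finite product of finite-dimensional manifolds, let $\pi_i : M\to M_i$ be the projections, and let $g$ be a pseudo-Riemannian metric on $M$ with contravariant metric $G$. Let $T$ be an orthogonal tensor on $(M,g)$, i.e. a symmetric contravariant 2-tensor field whose associated ($g$-self-adjoint) endomorphism field of $TM$ is pointwise diagonalizable over $\mathbb{R}$. Suppose that the product manifold is adapted to the eigenspaces of $T$: there are eigenfunctions $\lambda_1,\dots,\lambda_k : M\to\mathbb{R}$ of $T$ such that for every $i$ and every $p \in M$ the eigenspace $E_i(p)=\ker(T_p-\lambda_i(p) I)\neq 0$ is the tangent space at $p$ of the slice $\{p_1\}\times\dots\times\{p_{i-1}\}\times M_i\times\{p_{i+1}\}\times\dots\times\{p_k\}$ (in particular the eigenspaces are orthogonally integrable and $TM$ is the orthogonal direct sum of $E_1,\dots,E_k$). For a tangent vector $v$ let $v^{j}$ be its orthogonal projection onto $E_j$ and let $v^{\perp i}=v-v^{i}$ be its orthogonal projection onto $E_i^{\perp}$. Let $\nabla f$ denote the gradient of $f$. Then $T$ is a conformal Killing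 tensor, i.e. there is a vector field $C$ on $M$ such that the Schouten bracket of symmetric tensors satisfies $[T,G]=-2\,C\odot G$, if and only if $(M,g)$ is a twisted product with suitable twist functions, i.e. there are pseudo-Riemannian metrics $g_i$ on $M_i$ and smooth functions $\rho_i : M\to(0,\infty)$, $i=1,\dots,k$, such that $$g=\sum_{i=1}^{k}\rho_i^{2}\,\pi_i^{*}g_i$$ and, for every $i$, $$(\nabla\log\rho_i)^{\perp i}=\frac12\sum_{j\neq i}\bigl(\nabla\log|\lambda_i-\lambda_j|\bigr)^{j}.$$ -/

import Mathlib

open scoped Manifold ContDiff Bundle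
open Bundle

noncomputable section

/-! ### Pseudo-Riemannian metrics -/

section Metric

variable {E : Type*} [NormedAddCommGroup E] [NormedSpace ℝ E]
  {H : Type*} [TopologicalSpace H]

/-- A smooth pseudo-Riemannian metric on `M`: a smooth field of symmetric non-degenerate bilinear
forms on the tangent spaces. -/
structure PseudoRiemannianMetric (I : ModelWithCorners ℝ E H) (M : Type*) [TopologicalSpace M]
    [ChartedSpace H M] [IsManifold I ∞ M] where
  inner (x : M) : TangentSpace I x →L[ℝ] TangentSpace I x →L[ℝ] ℝ
  symm (x : M) (v w : TangentSpace I x) : inner x v w = inner x w v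
  nondegenerate (x : M) (v : TangentSpace I x) : (∀ w, inner x v w = 0) → v = 0
  contMDiff : ContMDiff I (I.prod 𝓘(ℝ, E →L[ℝ] E →L[ℝ] ℝ)) ∞
    (fun x ↦ TotalSpace.mk' (E →L[ℝ] E →L[ℝ] ℝ)
      (E := fun x : M ↦ TangentSpace I x →L[ℝ] TangentSpace I x →L[ℝ] ℝ) x (inner x))

variable {I : ModelWithCorners ℝ E H} {M : Type*} [TopologicalSpace M]
  [ChartedSpace H M] [IsManifold I ∞ M]

instance tangentSpace_finiteDimensional [FiniteDimensional ℝ E] (x : M) :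
    FiniteDimensional ℝ (TangentSpace I x) :=
  inferInstanceAs (FiniteDimensional ℝ E)

namespace PseudoRiemannianMetric

/-- The metric at a point as a bilinear form. -/
def form (g : PseudoRiemannianMetric I M) (x : M) : LinearMap.BilinForm ℝ (TangentSpace I x) :=
  LinearMap.mk₂ ℝ (fun v w ↦ g.inner x v w) (by simp) (by simp) (by simp) (by simp)

theorem form_nondegenerate (g : PseudoRiemannianMetric I M) (x : M) :
    (g.form x).Nondegenerate :=
  ⟨fun v hv ↦ g.nondegenerate x v hv,
    fun v hv ↦ g.nondegenerate x v fun w ↦ (g.symm x v w).trans (hv w)⟩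

variable [FiniteDimensional ℝ E]

/-- The tangent vector metrically equivalent to a covector. -/
def sharp (g : PseudoRiemannianMetric I M) (x : M) (α : TangentSpace I x →L[ℝ] ℝ) :
    TangentSpace I x :=
  ((g.form x).toDual (g.form_nondegenerate x)).symm α.toLinearMap

/-- The characteristic property of `sharp`. -/
theorem inner_sharp (g : PseudoRiemannianMetric I M) (x : M) (α : TangentSpace I x →L[ℝ] ℝ)
    (w : TangentSpace I x) : g.inner x (g.sharp x α) w = α w := by
  have h := LinearMap.BilinForm.apply_toDual_symm_apply (hB := g.form_nondegenerate x)
    α.toLinearMap w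
  exact h

/-- The gradient `∇ f`, the vector field metrically equivalent to `df`. -/
def grad (g : PseudoRiemannianMetric I M) (f : M → ℝ) (x : M) : TangentSpace I x :=
  g.sharp x (mvfderiv I f x)

/-- The contravariant form `K(α, β) = α (T β♯)` of an endomorphism field `T`. -/
def raise (g : PseudoRiemannianMetric I M)
    (T : (x : M) → TangentSpace I x →L[ℝ] TangentSpace I x) (x : M)
    (α β : TangentSpace I x →L[ℝ] ℝ) : ℝ :=
  α (T x (g.sharp x β))

/-- The contravariant metric `G(α, β) = α (β♯)`. -/
def contravariant (g : PseudoRiemannianMetric I M) (x : M)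
    (α β : TangentSpace I x →L[ℝ] ℝ) : ℝ :=
  α (g.sharp x β)

end PseudoRiemannianMetric

open Classical in
/-- The `g`-orthogonal projection of `v` onto a subspace `W` of a tangent space on which `g` is
non-degenerate (that is, one complementary to its orthogonal space); `0` by convention for other
`W`. -/
def PseudoRiemannianMetric.orthProj (g : PseudoRiemannianMetric I M) (x : M)
    (W : Submodule ℝ (TangentSpace I x)) (v : TangentSpace I x) : TangentSpace I x :=
  if h : IsCompl W ((g.form x).orthogonal W) then
    W.projection ((g.form x).orthogonal W) h v
  else 0

/-- `(v)^⊥`: the component of `v` orthogonal to `W`. -/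
def PseudoRiemannianMetric.perpProj (g : PseudoRiemannianMetric I M) (x : M)
    (W : Submodule ℝ (TangentSpace I x)) (v : TangentSpace I x) : TangentSpace I x :=
  v - g.orthProj x W v

/-! ### Orthogonal tensors and conformal Killing tensors -/

/-- The Schouten bracket `[K, L]` of symmetric contravariant 2-tensor fields, as a cubic form on
covectors, evaluated at the covector `df_x`.  Identifying a symmetric contravariant tensor with the
fibrewise polynomial `α ↦ K(α, α)` on the cotangent bundle, `[K, L]` is the Poisson bracket
`∂K/∂p_i ∂L/∂x^i - ∂L/∂p_i ∂K/∂x^i`; along the section `p = df` this is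
`2 (K(df, d(L(df, df))) - L(df, d(K(df, df))))`, the second derivatives of `f` cancelling. -/
def schoutenBracket (K L : (x : M) → (TangentSpace I x →L[ℝ] ℝ) → (TangentSpace I x →L[ℝ] ℝ) → ℝ)
    (f : M → ℝ) (x : M) : ℝ :=
  2 * (K x (mvfderiv I f x) (mvfderiv I (fun y ↦ L y (mvfderiv I f y) (mvfderiv I f y)) x)
    - L x (mvfderiv I f x) (mvfderiv I (fun y ↦ K y (mvfderiv I f y) (mvfderiv I f y)) x))

/-- An orthogonal tensor, given through its endomorphism field: smooth, with symmetric
contravariant form (i.e. `g`-self-adjoint), and pointwise diagonalizable over `ℝ`. -/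
structure IsOrthogonalTensor (g : PseudoRiemannianMetric I M)
    (T : (x : M) → TangentSpace I x →L[ℝ] TangentSpace I x) : Prop where
  contMDiff : ContMDiff I (I.prod 𝓘(ℝ, E →L[ℝ] E)) ∞
    (fun x ↦ TotalSpace.mk' (E →L[ℝ] E)
      (E := fun x : M ↦ TangentSpace I x →L[ℝ] TangentSpace I x) x (T x))
  selfAdjoint (x : M) (v w : TangentSpace I x) : g.inner x (T x v) w = g.inner x v (T x w)
  diagonalizable (x : M) : ⨆ μ : ℝ, Module.End.eigenspace (T x).toLinearMap μ = ⊤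

/-- `T` is a conformal Killing tensor: `[K, G] = -2 C ⊙ G` for some smooth vector field `C`, where
`K` is the contravariant form of `T` and `G` the contravariant metric.  Both sides are compared as
cubic forms on covectors; every covector at `x` is `df_x` for a function `f` smooth near `x`. -/
def IsConformalKilling [FiniteDimensional ℝ E] (g : PseudoRiemannianMetric I M)
    (T : (x : M) → TangentSpace I x →L[ℝ] TangentSpace I x) : Prop :=
  ∃ C : (x : M) → TangentSpace I x,
    ContMDiff I I.tangent ∞ (fun x ↦ (⟨x, C x⟩ : TangentBundle I M)) ∧
    ∀ (x : M) (f : M → ℝ), ContMDiffAt I 𝓘(ℝ, ℝ) ∞ f x →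
      schoutenBracket (I := I) (g.raise T) g.contravariant f x =
        -2 * (mvfderiv I f x (C x) * g.contravariant x (mvfderiv I f x) (mvfderiv I f x))

end Metric

/-! ### Product manifolds -/

section Product

variable {ι : Type*} [Fintype ι] {E : ι → Type*} [∀ i, NormedAddCommGroup (E i)]
  [∀ i, NormedSpace ℝ (E i)]

/-- The model of a finite product of manifolds modelled on the vector spaces `E i`. -/
abbrev piModel (E : ι → Type*) [∀ i, NormedAddCommGroup (E i)] [∀ i, NormedSpace ℝ (E i)] :
    ModelWithCorners ℝ (∀ i, E i) (ModelPi E) :=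
  ModelWithCorners.pi fun i ↦ 𝓘(ℝ, E i)

variable {M : ι → Type*} [∀ i, TopologicalSpace (M i)] [∀ i, ChartedSpace (E i) (M i)]

/-- A finite product of smooth manifolds is a smooth manifold. -/
instance isManifold_pi [∀ i, IsManifold 𝓘(ℝ, E i) ∞ (M i)] :
    IsManifold (piModel E) ∞ (∀ i, M i) := by
  apply isManifold_of_contDiffOn
  rintro _ _ ⟨e, he, rfl⟩ ⟨e', he', rfl⟩
  rw [contDiffOn_pi]
  intro i
  have hi : ContDiffOn ℝ ∞ ((e i).symm ≫ₕ e' i) ((e i).symm ≫ₕ e' i).source := by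
    have h := (HasGroupoid.compatible (G := contDiffGroupoid ∞ 𝓘(ℝ, E i))
      (he i (Set.mem_univ i)) (he' i (Set.mem_univ i))).1
    simpa [contDiffPregroupoid] using h
  refine hi.comp (ContinuousLinearMap.proj (R := ℝ) (φ := E) i).contDiff.contDiffOn ?_
  rintro x ⟨⟨hx, hx'⟩, -⟩
  exact ⟨hx i (Set.mem_univ i), hx' i (Set.mem_univ i)⟩

variable [∀ i, IsManifold 𝓘(ℝ, E i) ∞ (M i)]

/-- The distribution of the product net belonging to the `i`-th factor: at `x` it is the tangent
space of the slice `(x_1, …, x_{i-1}) × M_i × (x_{i+1}, …, x_k)`, that is, the space of the vectors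
annihilated by the derivatives of all the other projections. -/
def productNet (i : ι) (x : ∀ i, M i) : Submodule ℝ (TangentSpace (piModel E) x) :=
  ⨅ j : {j : ι // j ≠ i},
    LinearMap.ker (mfderiv (piModel E) 𝓘(ℝ, E j) (fun y : ∀ i, M i ↦ y j) x).toLinearMap

/-- The product manifold `∏ M_i` is adapted to the eigenspaces of the endomorphism field `T`, with
eigenfunctions `lam i`: at every point each `lam i` is an eigenvalue of `T`, and the slices of the
`i`-th factor are integral manifolds of the eigenspace `ker (T - lam i)`. -/
structure IsAdaptedToEigenspaces
    (T : (x : ∀ i, M i) → TangentSpace (piModel E) x →L[ℝ] TangentSpace (piModel E) x)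
    (lam : ι → (∀ i, M i) → ℝ) : Prop where
  hasEigenvalue (i : ι) (x : ∀ i, M i) :
    Module.End.HasEigenvalue (T x).toLinearMap (lam i x)
  eigenspace_eq (i : ι) (x : ∀ i, M i) :
    Module.End.eigenspace (T x).toLinearMap (lam i x) = productNet i x

/-- `g = ∑ ρ_i² π_i^* g_i` with smooth positive twist functions `ρ_i`. -/
structure IsTwistedProductMetric (g : PseudoRiemannianMetric (piModel E) (∀ i, M i))
    (gf : (i : ι) → PseudoRiemannianMetric 𝓘(ℝ, E i) (M i)) (ρ : ι → (∀ i, M i) → ℝ) :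
    Prop where
  contMDiff (i : ι) : ContMDiff (piModel E) 𝓘(ℝ, ℝ) ∞ (ρ i)
  pos (i : ι) (x : ∀ i, M i) : 0 < ρ i x
  inner_eq (x : ∀ i, M i) (v w : TangentSpace (piModel E) x) :
    g.inner x v w = ∑ i, ρ i x ^ 2 * (gf i).inner (x i)
      (mfderiv (piModel E) 𝓘(ℝ, E i) (fun y : ∀ i, M i ↦ y i) x v)
      (mfderiv (piModel E) 𝓘(ℝ, E i) (fun y : ∀ i, M i ↦ y i) x w)

end Product

end

/-!
The metric and the tensor are block diagonal with respect to the factors. Evaluated on `df`, the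
conformal Killing equation is a cubic form in `∇f`: all second derivatives of `f` cancel, because
the Hessian is symmetric and `T` is self-adjoint. Comparing coefficients of this cubic form, the
equation holds for some `C` if and only if `D ∂F = F ∂D` for every pair `i ≠ j`, where
`D = λᵢ - λⱼ`, `F` is the value of the `j`-th block of `g` on a fixed vector, and `∂` is any
derivative along the `i`-th factor. For a twisted product, `F` is `ρⱼ²` times a function constant
along the `i`-th factor, and this is the equation for `∇ log ρⱼ`. Conversely, it says that `F / D`
is constant along the (connected) `i`-th factor, so moving one coordinate after another to a base
point rescales the `j`-th block by the positive factor `ρⱼ²`, leaving a metric on the `j`-th factor.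
-/

open scoped Topology

noncomputable section

section ProductManifold

variable {ι : Type*} [Fintype ι] {E : ι → Type*} [∀ i, NormedAddCommGroup (E i)]
  [∀ i, NormedSpace ℝ (E i)]

instance piModel_boundaryless : (piModel E).Boundaryless where
  range_eq_univ := by
    change Set.range (Pi.map fun i ↦ (𝓘(ℝ, E i) : E i → E i)) = Set.univ
    simp

variable {M : ι → Type*} [∀ i, TopologicalSpace (M i)] [∀ i, ChartedSpace (E i) (M i)]

variable {E' H' N : Type*} [NormedAddCommGroup E'] [NormedSpace ℝ E'] [TopologicalSpace H']
  {I' : ModelWithCorners ℝ E' H'} [TopologicalSpace N] [ChartedSpace H' N]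

theorem contMDiffAt_pi_iff {n : WithTop ℕ∞} {f : N → ∀ i, M i} {x : N} :
    ContMDiffAt I' (piModel E) n f x ↔
      ∀ i, ContMDiffAt I' 𝓘(ℝ, E i) n (fun y ↦ f y i) x := by
  rw [contMDiffAt_iff_target, continuousAt_pi, contMDiffAt_pi_space, ← forall_and]
  exact forall_congr' fun i ↦
    (contMDiffAt_iff_target (I' := 𝓘(ℝ, E i)) (f := fun y ↦ f y i)).symm

theorem contMDiff_apply_pi {n : WithTop ℕ∞} (i : ι) :
    ContMDiff (piModel E) 𝓘(ℝ, E i) n (fun y : ∀ i, M i ↦ y i) :=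
  fun _ ↦ contMDiffAt_pi_iff.1 contMDiffAt_id i

theorem contMDiff_pi_iff {n : WithTop ℕ∞} {f : N → ∀ i, M i} :
    ContMDiff I' (piModel E) n f ↔ ∀ i, ContMDiff I' 𝓘(ℝ, E i) n (fun y ↦ f y i) :=
  ⟨fun h i x ↦ contMDiffAt_pi_iff.1 (h x) i, fun h x ↦ contMDiffAt_pi_iff.2 fun i ↦ h i x⟩

/-- The `i`-th component of a tangent vector of the product, which is the derivative of the `i`-th
projection: the charts of the product are the products of the charts of the factors. -/
def tangentProj (x : ∀ i, M i) (i : ι) : TangentSpace (piModel E) x →L[ℝ] E i :=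
  ContinuousLinearMap.proj (R := ℝ) (φ := E) i

theorem tangent_ext {x : ∀ i, M i} {v w : TangentSpace (piModel E) x}
    (h : ∀ i, tangentProj x i v = tangentProj x i w) : v = w :=
  funext h

theorem hasMFDerivAt_apply_pi (x : ∀ i, M i) (i : ι) :
    HasMFDerivAt (piModel E) 𝓘(ℝ, E i) (fun y : ∀ i, M i ↦ y i) x (tangentProj x i) := by
  refine ⟨(continuous_apply i).continuousAt, ?_⟩
  have hproj := (ContinuousLinearMap.proj (R := ℝ) (φ := E) i).hasFDerivAt
    (x := extChartAt (piModel E) x x)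
  refine (hproj.congr_of_eventuallyEq ?_).hasFDerivWithinAt
  have htarget := (continuous_apply i (A := E)).continuousAt.preimage_mem_nhds
    (x := extChartAt (piModel E) x x) (extChartAt_target_mem_nhds (I := 𝓘(ℝ, E i)) (x i))
  filter_upwards [htarget] with z hz
  exact (extChartAt 𝓘(ℝ, E i) (x i)).right_inv hz

theorem mfderiv_apply_pi (x : ∀ i, M i) (i : ι) (v : TangentSpace (piModel E) x) :
    mfderiv (piModel E) 𝓘(ℝ, E i) (fun y : ∀ i, M i ↦ y i) x v = tangentProj x i v := by
  rw [(hasMFDerivAt_apply_pi x i).mfderiv]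
  rfl

theorem tangentProj_mfderiv {f : N → ∀ i, M i} {x : N}
    (hf : MDifferentiableAt I' (piModel E) f x) (i : ι) (v : TangentSpace I' x) :
    tangentProj (f x) i (mfderiv I' (piModel E) f x v) =
      mfderiv I' 𝓘(ℝ, E i) (fun y ↦ f y i) x v := by
  have hcomp := ((hasMFDerivAt_apply_pi (f x) i).comp x hf.hasMFDerivAt).mfderiv
  exact (congrArg (fun L ↦ L v) hcomp).symm

theorem mem_productNet {x : ∀ i, M i} {i : ι} {v : TangentSpace (piModel E) x} :
    v ∈ productNet i x ↔ ∀ j, j ≠ i → tangentProj x j v = 0 := by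
  simp only [productNet, Submodule.mem_iInf, Subtype.forall, LinearMap.mem_ker]
  refine forall₂_congr fun j _ ↦ ?_
  rw [← mfderiv_apply_pi]
  rfl

variable [DecidableEq ι]

theorem contMDiff_update {n : WithTop ℕ∞} (x : ∀ i, M i) (i : ι) :
    ContMDiff 𝓘(ℝ, E i) (piModel E) n (fun y : M i ↦ Function.update x i y) := by
  rw [contMDiff_pi_iff]
  intro j
  by_cases h : j = i
  · subst h; simpa using! contMDiff_id
  · simpa [Function.update_of_ne h] using contMDiff_const

theorem contMDiff_update_const {n : WithTop ℕ∞} (i : ι) (a : M i) :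
    ContMDiff (piModel E) (piModel E) n (fun x : ∀ i, M i ↦ Function.update x i a) := by
  rw [contMDiff_pi_iff]
  intro j
  by_cases h : j = i
  · subst h; simpa using contMDiff_const
  · simpa [Function.update_of_ne h] using contMDiff_apply_pi j

/-- The inclusion of the tangent space of the `i`-th factor, as the tangent space of the slice
through `x`, into the tangent space of the product. -/
def tangentSingle (x : ∀ i, M i) (i : ι) : E i →L[ℝ] TangentSpace (piModel E) x :=
  ContinuousLinearMap.single ℝ E i

@[simp]
theorem tangentProj_tangentSingle_self (x : ∀ i, M i) (i : ι) (v : E i) :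
    tangentProj x i (tangentSingle x i v) = v :=
  Pi.single_eq_same i v

theorem tangentProj_tangentSingle_of_ne (x : ∀ i, M i) {i j : ι} (h : j ≠ i) (v : E i) :
    tangentProj x j (tangentSingle x i v) = 0 :=
  Pi.single_eq_of_ne h v

theorem sum_tangentSingle (x : ∀ i, M i) (v : TangentSpace (piModel E) x) :
    ∑ i, tangentSingle x i (tangentProj x i v) = v :=
  Finset.univ_sum_single (M := E) v

theorem tangentProj_sum_tangentSingle (x : ∀ i, M i) (s : Finset ι) (u : ∀ i, E i) (j : ι) :
    tangentProj x j (∑ i ∈ s, tangentSingle x i (u i)) = if j ∈ s then u j else 0 := by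
  rw [map_sum]
  exact Finset.sum_pi_single j u s

theorem mfderiv_update (x : ∀ i, M i) (i : ι) (y : M i) (v : TangentSpace 𝓘(ℝ, E i) y) :
    mfderiv 𝓘(ℝ, E i) (piModel E) (fun y : M i ↦ Function.update x i y) y v =
      tangentSingle (Function.update x i y) i v := by
  apply tangent_ext
  intro j
  rw [tangentProj_mfderiv ((contMDiff_update (n := 1) x i).mdifferentiable one_ne_zero y)]
  by_cases h : j = i
  · subst h
    have hid : (fun y : M j ↦ Function.update x j y j) = id := by ext; simp
    rw [hid, mfderiv_id]
    exact (tangentProj_tangentSingle_self (Function.update x j y) j v).symm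
  · have hconst : (fun y : M i ↦ Function.update x i y j) = fun _ ↦ x j := by
      ext; simp [Function.update_of_ne h]
    rw [hconst, mfderiv_const]
    exact (tangentProj_tangentSingle_of_ne (Function.update x i y) h v).symm

theorem tangentSingle_mem_productNet (x : ∀ i, M i) (i : ι) (v : E i) :
    tangentSingle x i v ∈ productNet i x :=
  mem_productNet.2 fun _ hj ↦ tangentProj_tangentSingle_of_ne x hj v

theorem tangentSingle_tangentProj_of_mem {x : ∀ i, M i} {i : ι} {v : TangentSpace (piModel E) x}
    (hv : v ∈ productNet i x) : tangentSingle x i (tangentProj x i v) = v := by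
  apply tangent_ext
  intro j
  by_cases h : j = i
  · subst h; simp
  · rw [tangentProj_tangentSingle_of_ne _ h, mem_productNet.1 hv j h]

end ProductManifold

section ChartFrame

variable {E : Type*} [NormedAddCommGroup E] [NormedSpace ℝ E]
  {H : Type*} [TopologicalSpace H] (I : ModelWithCorners ℝ E H)
  {M : Type*} [TopologicalSpace M] [ChartedSpace H M]
  {F : Type*} [NormedAddCommGroup F] [NormedSpace ℝ F]

variable {I} in
theorem contDiffAt_comp_extChartAt_symm [I.Boundaryless] {n : WithTop ℕ∞} {f : M → F} {x : M}
    (hf : ContMDiffAt I 𝓘(ℝ, F) n f x) :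
    ContDiffAt ℝ n (f ∘ (extChartAt I x).symm) (extChartAt I x x) := by
  have hwithin := (contMDiffAt_iff.1 hf).2
  rwa [I.range_eq_univ, contDiffWithinAt_univ] at hwithin

variable [IsManifold I ∞ M]

variable {I} in
theorem mdifferentiableAt_extChartAt_symm [I.Boundaryless] {x : M} {z : E}
    (hz : z ∈ (extChartAt I x).target) :
    MDifferentiableAt 𝓘(ℝ, E) I (extChartAt I x).symm z := by
  have hwithin := mdifferentiableWithinAt_extChartAt_symm (I := I) hz
  rwa [I.range_eq_univ, mdifferentiableWithinAt_univ] at hwithin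

/-- The coordinate frame of the tangent bundle over the domain of the preferred chart at `x₀`, as a
family of linear maps from the model space. -/
def chartFrame (x₀ y : M) : E →L[ℝ] TangentSpace I y :=
  (trivializationAt E (TangentSpace I) x₀).symmL ℝ y

/-- The coordinates of tangent vectors in `chartFrame`. -/
def chartCoframe (x₀ y : M) : TangentSpace I y →L[ℝ] E :=
  (trivializationAt E (TangentSpace I) x₀).continuousLinearMapAt ℝ y

variable {I}

theorem chartFrame_chartCoframe {x₀ y : M} (hy : y ∈ (chartAt H x₀).source)
    (v : TangentSpace I y) : chartFrame I x₀ y (chartCoframe I x₀ y v) = v :=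
  (trivializationAt E (TangentSpace I) x₀).symmL_continuousLinearMapAt
    (by simpa using hy) v

theorem chartCoframe_chartFrame {x₀ y : M} (hy : y ∈ (chartAt H x₀).source) (v : E) :
    chartCoframe I x₀ y (chartFrame I x₀ y v) = v :=
  (trivializationAt E (TangentSpace I) x₀).continuousLinearMapAt_symmL
    (by simpa using hy) v

theorem chartFrame_self (x : M) (v : E) : chartFrame I x x v = v := by
  unfold chartFrame
  rw [TangentBundle.symmL_trivializationAt_eq_core (mem_chart_source H x)]
  exact (tangentBundleCore I M).coordChange_self (achart H x) x (mem_chart_source H x) v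

theorem contMDiffAt_chartFrame {x₀ y : M} (hy : y ∈ (chartAt H x₀).source) (v : E) :
    ContMDiffAt I I.tangent ∞
      (fun y ↦ (⟨y, chartFrame I x₀ y v⟩ : TangentBundle I M)) y := by
  have hsymmL := (trivializationAt E (TangentSpace I) x₀).contMDiffAt_symmL (IB := I) (n := ∞)
    (x := y) (by simpa using hy)
  exact hsymmL.clm_bundle_apply (E₁ := fun _ ↦ E) (v := fun _ ↦ v)
    ((contMDiffAt_totalSpace (E := Bundle.Trivial M E)).2 ⟨contMDiffAt_id, contMDiffAt_const⟩)

theorem mvfderiv_chartFrame [I.Boundaryless] {x₀ y : M} (hy : y ∈ (chartAt H x₀).source)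
    {f : M → F} (hf : MDifferentiableAt I 𝓘(ℝ, F) f y) (v : E) :
    mvfderiv I f y (chartFrame I x₀ y v) =
      fderiv ℝ (f ∘ (extChartAt I x₀).symm) (extChartAt I x₀ y) v := by
  unfold chartFrame
  rw [TangentBundle.symmL_trivializationAt hy, I.range_eq_univ, mfderivWithin_univ]
  have hy' : y ∈ (extChartAt I x₀).source := by simpa using hy
  have hleft : (extChartAt I x₀).symm (extChartAt I x₀ y) = y := (extChartAt I x₀).left_inv hy'
  have hcomp := mfderiv_comp_of_eq hf
    (mdifferentiableAt_extChartAt_symm ((extChartAt I x₀).map_source hy')) hleft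
  rw [mfderiv_eq_fderiv, hleft] at hcomp
  exact (congrArg (fun L ↦ L v) hcomp).symm

theorem mvfderiv_apply_eq_fderiv [I.Boundaryless] {f : M → F} {x : M}
    (hf : MDifferentiableAt I 𝓘(ℝ, F) f x) (v : E) :
    mvfderiv I f x v = fderiv ℝ (f ∘ (extChartAt I x).symm) (extChartAt I x x) v := by
  rw [← mvfderiv_chartFrame (mem_chart_source H x) hf, chartFrame_self]

/-- A field of bilinear forms in the coordinates of the preferred chart at `x₀`. -/
def bilinCoord (b : (y : M) → TangentSpace I y →L[ℝ] TangentSpace I y →L[ℝ] ℝ) (x₀ y : M) :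
    E →L[ℝ] E →L[ℝ] ℝ :=
  (show E →L[ℝ] E →L[ℝ] ℝ from b y).bilinearComp
    (show E →L[ℝ] E from chartFrame I x₀ y) (show E →L[ℝ] E from chartFrame I x₀ y)

theorem bilinCoord_apply (b : (y : M) → TangentSpace I y →L[ℝ] TangentSpace I y →L[ℝ] ℝ)
    (x₀ y : M) (v w : E) :
    bilinCoord b x₀ y v w = b y (chartFrame I x₀ y v) (chartFrame I x₀ y w) := rfl

theorem contMDiffAt_bilin_iff {b : (y : M) → TangentSpace I y →L[ℝ] TangentSpace I y →L[ℝ] ℝ}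
    {x₀ : M} :
    ContMDiffAt I (I.prod 𝓘(ℝ, E →L[ℝ] E →L[ℝ] ℝ)) ∞
      (fun x ↦ TotalSpace.mk' (E →L[ℝ] E →L[ℝ] ℝ)
        (E := fun x : M ↦ TangentSpace I x →L[ℝ] TangentSpace I x →L[ℝ] ℝ) x (b x)) x₀ ↔
      ContMDiffAt I 𝓘(ℝ, E →L[ℝ] E →L[ℝ] ℝ) ∞ (bilinCoord b x₀) x₀ := by
  rw [contMDiffAt_hom_bundle]
  refine Iff.trans (and_iff_right contMDiffAt_id) (Filter.EventuallyEq.contMDiffAt_iff ?_)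
  filter_upwards [chart_source_mem_nhds H x₀] with y hy
  ext v w
  rw [bilinCoord_apply]
  have hbase : y ∈ (trivializationAt (E →L[ℝ] ℝ)
      (fun x : M ↦ TangentSpace I x →L[ℝ] ℝ) x₀).baseSet := by
    simp [hom_trivializationAt_baseSet, hy]
  rw [ContinuousLinearMap.inCoordinates]
  simp [chartFrame, hom_trivializationAt_apply, ContinuousLinearMap.inCoordinates,
    Trivialization.continuousLinearMapAt_apply, Trivialization.coe_linearMapAt_of_mem _ hbase]

namespace PseudoRiemannianMetric

/-- The metric in the coordinates of the preferred chart at `x₀`. -/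
def coord (g : PseudoRiemannianMetric I M) (x₀ y : M) : E →L[ℝ] E →L[ℝ] ℝ :=
  bilinCoord g.inner x₀ y

theorem coord_apply (g : PseudoRiemannianMetric I M) (x₀ y : M) (v w : E) :
    g.coord x₀ y v w = g.inner y (chartFrame I x₀ y v) (chartFrame I x₀ y w) := rfl

theorem contMDiffAt_coord (g : PseudoRiemannianMetric I M) (x₀ : M) :
    ContMDiffAt I 𝓘(ℝ, E →L[ℝ] E →L[ℝ] ℝ) ∞ (g.coord x₀) x₀ :=
  contMDiffAt_bilin_iff.1 (g.contMDiff x₀)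

theorem contMDiffAt_coord_apply (g : PseudoRiemannianMetric I M) (x₀ : M) (v w : E) :
    ContMDiffAt I 𝓘(ℝ, ℝ) ∞ (fun y ↦ g.coord x₀ y v w) x₀ :=
  ((g.contMDiffAt_coord x₀).clm_apply contMDiffAt_const).clm_apply contMDiffAt_const

end PseudoRiemannianMetric

end ChartFrame

section Calculus

variable {V : Type*} [NormedAddCommGroup V] [NormedSpace ℝ V]

theorem exists_continuousLinearEquiv_of_separating [FiniteDimensional ℝ V] (B : V →L[ℝ] V →L[ℝ] ℝ)
    (hB : ∀ v, (∀ w, B v w = 0) → v = 0) :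
    ∃ e : V ≃L[ℝ] (V →L[ℝ] ℝ), (e : V →L[ℝ] V →L[ℝ] ℝ) = B := by
  have hinj : Function.Injective (B : V →ₗ[ℝ] V →L[ℝ] ℝ) := by
    rw [injective_iff_map_eq_zero]
    exact fun v hv ↦ hB v fun w ↦ congrArg (fun L ↦ L w) hv
  have hdim : Module.finrank ℝ V = Module.finrank ℝ (V →L[ℝ] ℝ) := by
    rw [← (LinearMap.toContinuousLinearMap : (V →ₗ[ℝ] ℝ) ≃ₗ[ℝ] V →L[ℝ] ℝ).finrank_eq]
    exact (Subspace.dual_finrank_eq (K := ℝ) (V := V)).symm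
  exact ⟨(LinearEquiv.ofInjectiveOfFinrankEq _ hinj hdim).toContinuousLinearEquiv, rfl⟩

variable {E H M : Type*} [NormedAddCommGroup E] [NormedSpace ℝ E] [TopologicalSpace H]
  {I : ModelWithCorners ℝ E H} [TopologicalSpace M] [ChartedSpace H M]

theorem contMDiffAt_of_clm_apply_eq [FiniteDimensional ℝ V] {n : WithTop ℕ∞} {x : M}
    {B : M → V →L[ℝ] V →L[ℝ] ℝ} {A : M → V →L[ℝ] ℝ} {X : M → V}
    (hB : ContMDiffAt I 𝓘(ℝ, V →L[ℝ] V →L[ℝ] ℝ) n B x)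
    (hA : ContMDiffAt I 𝓘(ℝ, V →L[ℝ] ℝ) n A x) (hsep : ∀ v, (∀ w, B x v w = 0) → v = 0)
    (hX : ∀ᶠ y in 𝓝 x, B y (X y) = A y) : ContMDiffAt I 𝓘(ℝ, V) n X x := by
  obtain ⟨e, he⟩ := exists_continuousLinearEquiv_of_separating (B x) hsep
  have hinverse : ContMDiffAt I 𝓘(ℝ, (V →L[ℝ] ℝ) →L[ℝ] V) n (fun y ↦ (B y).inverse) x := by
    have hmap := (contDiffAt_map_inverse (𝕜 := ℝ) (n := n) e).contMDiffAt
    rw [he] at hmap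
    exact hmap.comp x hB
  have hequiv : ∀ᶠ L in 𝓝 (B x), ∃ e' : V ≃L[ℝ] (V →L[ℝ] ℝ), (e' : V →L[ℝ] V →L[ℝ] ℝ) = L :=
    he ▸ e.nhds
  refine (hinverse.clm_apply hA).congr_of_eventuallyEq ?_
  filter_upwards [hX, hB.continuousAt.eventually hequiv] with y hy ⟨e', he'⟩
  rw [← hy, ← he']
  simp

variable {F : Type*} [NormedAddCommGroup F] [NormedSpace ℝ F]

theorem mvfderiv_congr_of_eventuallyEq {f f' : M → F} {x : M} (h : f =ᶠ[𝓝 x] f')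
    (a : TangentSpace I x) : mvfderiv I f x a = mvfderiv I f' x a :=
  congrArg (fun L : TangentSpace I x →L[ℝ] F ↦ L a) (h.mfderiv_eq (I := I) (I' := 𝓘(ℝ, F)))

theorem mvfderiv_clm_apply {A : M → V →L[ℝ] F} {u : M → V} {x : M}
    (hA : MDifferentiableAt I 𝓘(ℝ, V →L[ℝ] F) A x) (hu : MDifferentiableAt I 𝓘(ℝ, V) u x)
    (a : TangentSpace I x) :
    mvfderiv I (fun y ↦ A y (u y)) x a = A x (mvfderiv I u x a) + mvfderiv I A x a (u x) := by
  have h : HasMFDerivAt I 𝓘(ℝ, F) (fun y ↦ A y (u y)) x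
      (show E →L[ℝ] F from (A x).comp (mvfderiv I u x) +
        (ContinuousLinearMap.apply ℝ F (u x)).comp (mvfderiv I A x)) :=
    ⟨hA.continuousAt.clm_apply hu.continuousAt, by
      simpa using! hA.hasMFDerivAt.2.clm_apply hu.hasMFDerivAt.2⟩
  exact congrArg (fun L ↦ L a) h.mfderiv

theorem mvfderiv_clm_apply_const {A : M → V →L[ℝ] F} {x : M}
    (hA : MDifferentiableAt I 𝓘(ℝ, V →L[ℝ] F) A x) (v : V) (a : TangentSpace I x) :
    mvfderiv I (fun y ↦ A y v) x a = mvfderiv I A x a v := by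
  simpa [mvfderiv_const] using mvfderiv_clm_apply hA mdifferentiableAt_const a

theorem mvfderiv_bilin_apply_self {B : M → V →L[ℝ] V →L[ℝ] ℝ} {u : M → V} {x : M}
    (hB : MDifferentiableAt I 𝓘(ℝ, V →L[ℝ] V →L[ℝ] ℝ) B x) (hu : MDifferentiableAt I 𝓘(ℝ, V) u x)
    (hsymm : ∀ v w, B x v w = B x w v) (a : TangentSpace I x) :
    mvfderiv I (fun y ↦ B y (u y) (u y)) x a =
      2 * mvfderiv I (fun y ↦ B y (u y) (u x)) x a -
        mvfderiv I (fun y ↦ B y (u x) (u x)) x a := by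
  have hBu := hB.clm_apply hu
  rw [mvfderiv_clm_apply hBu hu, mvfderiv_clm_apply_const hBu, mvfderiv_clm_apply hB hu,
    mvfderiv_clm_apply_const (hB.clm_apply mdifferentiableAt_const), mvfderiv_clm_apply_const hB]
  simp only [add_apply]
  rw [hsymm (u x)]
  ring

theorem mdifferentiableAt_fun_sum {κ : Type*} {s : Finset κ} {f : κ → M → F} {x : M}
    (hf : ∀ k ∈ s, MDifferentiableAt I 𝓘(ℝ, F) (f k) x) :
    MDifferentiableAt I 𝓘(ℝ, F) (fun y ↦ ∑ k ∈ s, f k y) x := by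
  classical
  induction s using Finset.induction_on with
  | empty => simpa using mdifferentiableAt_const
  | insert k s hk ih =>
    simp only [Finset.sum_insert hk]
    exact (hf k (Finset.mem_insert_self k s)).add
      (ih fun l hl ↦ hf l (Finset.mem_insert_of_mem hl))

theorem mvfderiv_fun_sum {κ : Type*} {s : Finset κ} {f : κ → M → F} {x : M}
    (hf : ∀ k ∈ s, MDifferentiableAt I 𝓘(ℝ, F) (f k) x) :
    mvfderiv I (fun y ↦ ∑ k ∈ s, f k y) x = ∑ k ∈ s, mvfderiv I (f k) x := by
  classical
  induction s using Finset.induction_on with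
  | empty => simp [mvfderiv_const]
  | insert k s hk ih =>
    have hs : ∀ l ∈ s, MDifferentiableAt I 𝓘(ℝ, F) (f l) x := fun l hl ↦
      hf l (Finset.mem_insert_of_mem hl)
    simp only [Finset.sum_insert hk]
    rw [mvfderiv_fun_add (hf k (Finset.mem_insert_self k s)) (mdifferentiableAt_fun_sum hs), ih hs]

theorem mvfderiv_log {f : M → ℝ} {x : M} (hf : MDifferentiableAt I 𝓘(ℝ, ℝ) f x) (hx : f x ≠ 0) :
    mvfderiv I (fun y ↦ Real.log (f y)) x = (f x)⁻¹ • mvfderiv I f x := by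
  ext a
  refine (mvfderiv_comp_apply x (Real.differentiableAt_log hx).mdifferentiableAt hf a).trans ?_
  rw [mvfderiv, mfderiv_eq_fderiv, (Real.hasDerivAt_log hx).hasFDerivAt.fderiv]
  exact mul_comm _ _

end Calculus

section Coordinates

variable {E : Type*} [NormedAddCommGroup E] [NormedSpace ℝ E]
  {H : Type*} [TopologicalSpace H] {I : ModelWithCorners ℝ E H}
  {M : Type*} [TopologicalSpace M] [ChartedSpace H M] [IsManifold I ∞ M]

/-- The differential of a function in the coordinates of the preferred chart at `x₀`. -/
def diffCoord (I : ModelWithCorners ℝ E H) [IsManifold I ∞ M] (f : M → ℝ) (x₀ y : M) : E →L[ℝ] ℝ :=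
  (mvfderiv I f y).comp (chartFrame I x₀ y)

/-- The second derivative at `x` of a function in the coordinates of the preferred chart at `x`. -/
def coordHessian (I : ModelWithCorners ℝ E H) [IsManifold I ∞ M] (f : M → ℝ) (x : M) :
    TangentSpace I x →L[ℝ] E →L[ℝ] ℝ :=
  mvfderiv I (diffCoord I f x) x

section Boundaryless

variable [I.Boundaryless] {f : M → ℝ} {x : M}

theorem diffCoord_eventuallyEq (hf : ContMDiffAt I 𝓘(ℝ, ℝ) ∞ f x) :
    diffCoord I f x =ᶠ[𝓝 x] fderiv ℝ (f ∘ (extChartAt I x).symm) ∘ extChartAt I x := by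
  have hdiff : ∀ᶠ y in 𝓝 x, ContMDiffAt I 𝓘(ℝ, ℝ) 1 f y :=
    (contMDiffAt_iff_contMDiffAt_nhds (by simp)).1 (hf.of_le (by exact_mod_cast le_top))
  filter_upwards [hdiff, chart_source_mem_nhds H x] with y hfy hy
  ext v
  exact mvfderiv_chartFrame hy (hfy.mdifferentiableAt one_ne_zero) v

theorem contMDiffAt_diffCoord (hf : ContMDiffAt I 𝓘(ℝ, ℝ) ∞ f x) :
    ContMDiffAt I 𝓘(ℝ, E →L[ℝ] ℝ) ∞ (diffCoord I f x) x := by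
  refine ContMDiffAt.congr_of_eventuallyEq ?_ (diffCoord_eventuallyEq hf)
  exact ((contDiffAt_comp_extChartAt_symm hf).fderiv_right (m := ∞) (by simp)).contMDiffAt.comp x
    contMDiffAt_extChartAt

theorem coordHessian_apply (hf : ContMDiffAt I 𝓘(ℝ, ℝ) ∞ f x) (a w : E) :
    coordHessian I f x a w =
      fderiv ℝ (fderiv ℝ (f ∘ (extChartAt I x).symm)) (extChartAt I x x) a w := by
  have hsymm : Filter.Tendsto (extChartAt I x).symm (𝓝 (extChartAt I x x)) (𝓝 x) := by
    simpa only [ContinuousAt, extChartAt_to_inv] using continuousAt_extChartAt_symm (I := I) x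
  have hcomp : diffCoord I f x ∘ (extChartAt I x).symm =ᶠ[𝓝 (extChartAt I x x)]
      fderiv ℝ (f ∘ (extChartAt I x).symm) := by
    filter_upwards [hsymm.eventually (diffCoord_eventuallyEq hf),
      extChartAt_target_mem_nhds (I := I) x] with z hz hztarget
    rw [Function.comp_apply, hz, Function.comp_apply, (extChartAt I x).right_inv hztarget]
  rw [coordHessian, mvfderiv_apply_eq_fderiv
    ((contMDiffAt_diffCoord hf).mdifferentiableAt (by simp)), hcomp.fderiv_eq]

theorem coordHessian_symm (hf : ContMDiffAt I 𝓘(ℝ, ℝ) ∞ f x) (v w : E) :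
    coordHessian I f x v w = coordHessian I f x w v := by
  rw [coordHessian_apply hf, coordHessian_apply hf]
  exact (contDiffAt_comp_extChartAt_symm hf).isSymmSndFDerivAt
    (by simpa using ENat.LEInfty.out) v w

end Boundaryless

theorem contMDiffAt_vectorField_iff {X : ∀ y : M, TangentSpace I y} {x : M} :
    ContMDiffAt I I.tangent ∞ (fun y ↦ (⟨y, X y⟩ : TangentBundle I M)) x ↔
      ContMDiffAt I 𝓘(ℝ, E) ∞ (fun y ↦ chartCoframe I x y (X y)) x := by
  rw [contMDiffAt_section]
  apply Filter.EventuallyEq.contMDiffAt_iff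
  filter_upwards [chart_source_mem_nhds H x] with y hy
  have hbase : y ∈ (trivializationAt E (TangentSpace I) x).baseSet := by simpa using hy
  simp [chartCoframe, Trivialization.continuousLinearMapAt_apply,
    Trivialization.coe_linearMapAt_of_mem _ hbase]

namespace PseudoRiemannianMetric

variable (g : PseudoRiemannianMetric I M)

theorem coord_symm (x₀ y : M) (v w : E) : g.coord x₀ y v w = g.coord x₀ y w v :=
  g.symm y _ _

theorem coord_separating {x₀ y : M} (hy : y ∈ (chartAt H x₀).source) (v : E)
    (hv : ∀ w, g.coord x₀ y v w = 0) : v = 0 := by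
  have hframe : chartFrame I x₀ y v = 0 := by
    refine g.nondegenerate y _ fun w ↦ ?_
    rw [← chartFrame_chartCoframe (I := I) hy w]
    exact hv _
  rw [← chartCoframe_chartFrame (I := I) hy v, hframe, map_zero]

variable [FiniteDimensional ℝ E]

theorem inner_grad (f : M → ℝ) (x : M) (w : TangentSpace I x) :
    g.inner x (g.grad f x) w = mvfderiv I f x w :=
  g.inner_sharp x _ w

theorem contravariant_apply (x : M) (α β : TangentSpace I x →L[ℝ] ℝ) :
    g.contravariant x α β = β (g.sharp x α) := by
  rw [← g.inner_sharp x β, g.symm, g.inner_sharp]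
  rfl

theorem raise_apply {T : (x : M) → TangentSpace I x →L[ℝ] TangentSpace I x} {x : M}
    (hT : ∀ v w, g.inner x (T x v) w = g.inner x v (T x w)) (α β : TangentSpace I x →L[ℝ] ℝ) :
    g.raise T x α β = β (T x (g.sharp x α)) := by
  rw [← g.inner_sharp x β, g.symm, hT, g.inner_sharp]
  rfl

theorem exists_grad_eq [I.Boundaryless] (x : M) (X : TangentSpace I x) :
    ∃ f : M → ℝ, ContMDiffAt I 𝓘(ℝ, ℝ) ∞ f x ∧ g.grad f x = X := by
  let α : E →L[ℝ] ℝ := g.inner x X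
  have hsmooth : ContMDiffAt I 𝓘(ℝ, ℝ) ∞ (α ∘ extChartAt I x) x :=
    α.contMDiff.contMDiffAt.comp x contMDiffAt_extChartAt
  have hα : (α ∘ extChartAt I x) ∘ (extChartAt I x).symm =ᶠ[𝓝 (extChartAt I x x)] α := by
    filter_upwards [extChartAt_target_mem_nhds (I := I) x] with z hz
    exact congrArg α ((extChartAt I x).right_inv hz)
  refine ⟨α ∘ extChartAt I x, hsmooth, sub_eq_zero.1 (g.nondegenerate x _ fun w ↦ ?_)⟩
  have hderiv := mvfderiv_apply_eq_fderiv (hsmooth.mdifferentiableAt (by simp)) w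
  rw [hα.fderiv_eq, α.fderiv] at hderiv
  rw [map_sub, sub_apply, inner_grad, hderiv]
  exact sub_self _

/-- The gradient in the coordinates of the preferred chart at `x₀`. -/
def gradCoord (f : M → ℝ) (x₀ y : M) : E :=
  chartCoframe I x₀ y (g.grad f y)

theorem gradCoord_self (f : M → ℝ) (x : M) : g.gradCoord f x x = g.grad f x := by
  rw [← chartFrame_self (I := I) x (g.gradCoord f x x)]
  exact chartFrame_chartCoframe (mem_chart_source H x) (g.grad f x)

theorem coord_gradCoord (f : M → ℝ) {x₀ y : M} (hy : y ∈ (chartAt H x₀).source) :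
    g.coord x₀ y (g.gradCoord f x₀ y) = diffCoord I f x₀ y := by
  ext w
  rw [coord_apply, gradCoord, chartFrame_chartCoframe hy, inner_grad]
  rfl

theorem contMDiffAt_gradCoord [I.Boundaryless] {f : M → ℝ} {x : M}
    (hf : ContMDiffAt I 𝓘(ℝ, ℝ) ∞ f x) : ContMDiffAt I 𝓘(ℝ, E) ∞ (g.gradCoord f x) x := by
  refine contMDiffAt_of_clm_apply_eq (g.contMDiffAt_coord x) (contMDiffAt_diffCoord hf)
    (g.coord_separating (mem_chart_source H x)) ?_
  filter_upwards [chart_source_mem_nhds H x] with y hy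
  exact g.coord_gradCoord f hy

end PseudoRiemannianMetric

end Coordinates

section ProductFrame

theorem mem_chartAt_pi_source {ι : Type*} [Finite ι] {H M : ι → Type*}
    [∀ i, TopologicalSpace (H i)] [∀ i, TopologicalSpace (M i)] [∀ i, ChartedSpace (H i) (M i)]
    {x y : ∀ i, M i} :
    y ∈ (chartAt (ModelPi H) x).source ↔ ∀ i, y i ∈ (chartAt (H i) (x i)).source := by
  rw [piChartedSpace_chartAt]
  exact Set.mem_univ_pi

theorem update_mem_chartAt_pi_source {ι : Type*} [Finite ι] [DecidableEq ι] {H M : ι → Type*}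
    [∀ i, TopologicalSpace (H i)] [∀ i, TopologicalSpace (M i)] [∀ i, ChartedSpace (H i) (M i)]
    {x : ∀ i, M i} {i : ι} {y : M i} (hy : y ∈ (chartAt (H i) (x i)).source) :
    Function.update x i y ∈ (chartAt (ModelPi H) x).source := by
  rw [mem_chartAt_pi_source]
  intro j
  by_cases hj : j = i
  · subst hj; simpa using hy
  · simp [Function.update_of_ne hj]

variable {ι : Type*} [Fintype ι] {E : ι → Type*} [∀ i, NormedAddCommGroup (E i)]
  [∀ i, NormedSpace ℝ (E i)] {M : ι → Type*} [∀ i, TopologicalSpace (M i)]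
  [∀ i, ChartedSpace (E i) (M i)] [∀ i, IsManifold 𝓘(ℝ, E i) ∞ (M i)]

theorem tangentProj_chartFrame {x y : ∀ i, M i} (hy : y ∈ (chartAt (ModelPi E) x).source)
    (j : ι) (v : ∀ i, E i) :
    tangentProj y j (chartFrame (piModel E) x y v) =
      chartFrame 𝓘(ℝ, E j) (x j) (y j) (v j) := by
  have hyj := mem_chartAt_pi_source.1 hy j
  unfold chartFrame
  rw [TangentBundle.symmL_trivializationAt hy, TangentBundle.symmL_trivializationAt hyj,
    (piModel E).range_eq_univ, (𝓘(ℝ, E j)).range_eq_univ, mfderivWithin_univ, mfderivWithin_univ]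
  have hsymm := mdifferentiableAt_extChartAt_symm (I := piModel E)
    ((extChartAt (piModel E) x).map_source (x := y) (by simpa using hy))
  have hsymmj := mdifferentiableAt_extChartAt_symm (I := 𝓘(ℝ, E j))
    ((extChartAt 𝓘(ℝ, E j) (x j)).map_source (x := y j) (by simpa using hyj))
  have hcomp := (HasMFDerivAt.comp (extChartAt (piModel E) x y)
    (g := (extChartAt 𝓘(ℝ, E j) (x j)).symm) hsymmj.hasMFDerivAt
    (ContinuousLinearMap.proj (R := ℝ) (φ := E) j).hasMFDerivAt).mfderiv
  exact (tangentProj_mfderiv hsymm j v).trans (congrArg (fun L ↦ L v) hcomp)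

variable [DecidableEq ι]

theorem chartFrame_single {x y : ∀ i, M i} (hy : y ∈ (chartAt (ModelPi E) x).source)
    (j : ι) (v : E j) :
    chartFrame (piModel E) x y (Pi.single j v) =
      tangentSingle y j (chartFrame 𝓘(ℝ, E j) (x j) (y j) v) := by
  apply tangent_ext
  intro k
  rw [tangentProj_chartFrame hy]
  by_cases h : k = j
  · subst h
    rw [Pi.single_eq_same]
    exact (tangentProj_tangentSingle_self y k _).symm
  · rw [Pi.single_eq_of_ne h, map_zero]
    exact (tangentProj_tangentSingle_of_ne y h _).symm

theorem chartFrame_single_apply {x y : ∀ i, M i} (hy : y ∈ (chartAt (ModelPi E) x).source)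
    (j : ι) (v : ∀ i, E i) :
    chartFrame (piModel E) x y (Pi.single j (v j)) =
      tangentSingle y j (tangentProj y j (chartFrame (piModel E) x y v)) := by
  rw [tangentProj_chartFrame hy]
  exact chartFrame_single hy j (v j)

end ProductFrame

section BlockDiagonal

variable {ι : Type*} [Fintype ι] {E : ι → Type*} [∀ i, NormedAddCommGroup (E i)]
  [∀ i, NormedSpace ℝ (E i)] {M : ι → Type*} [∀ i, TopologicalSpace (M i)]
  [∀ i, ChartedSpace (E i) (M i)]

namespace IsAdaptedToEigenspaces

variable {T : (x : ∀ i, M i) → TangentSpace (piModel E) x →L[ℝ] TangentSpace (piModel E) x}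
  {lam : ι → (∀ i, M i) → ℝ}

theorem exists_mem_productNet_ne_zero (h : IsAdaptedToEigenspaces T lam) (x : ∀ i, M i) (i : ι) :
    ∃ v ∈ productNet (E := E) i x, v ≠ 0 := by
  rw [← h.eigenspace_eq]
  exact (Submodule.ne_bot_iff _).1 (h.hasEigenvalue i x)

theorem nontrivial [Nonempty (∀ i, M i)] (h : IsAdaptedToEigenspaces T lam) (i : ι) :
    Nontrivial (E i) := by
  classical
  obtain ⟨x⟩ := ‹Nonempty (∀ i, M i)›
  obtain ⟨v, hv, hv0⟩ := h.exists_mem_productNet_ne_zero x i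
  refine ⟨tangentProj x i v, 0, fun hproj ↦ hv0 ?_⟩
  rw [← tangentSingle_tangentProj_of_mem hv, hproj, map_zero]

theorem lam_ne (h : IsAdaptedToEigenspaces T lam) (x : ∀ i, M i) {i j : ι} (hij : i ≠ j) :
    lam i x ≠ lam j x := by
  classical
  intro heq
  obtain ⟨v, hvi, hv0⟩ := h.exists_mem_productNet_ne_zero x i
  have hvj : v ∈ productNet j x := by rwa [← h.eigenspace_eq, ← heq, h.eigenspace_eq]
  exact hv0 (by rw [← tangentSingle_tangentProj_of_mem hvi, mem_productNet.1 hvj i hij, map_zero])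

variable [DecidableEq ι]

theorem apply_tangentSingle (h : IsAdaptedToEigenspaces T lam) (x : ∀ i, M i) (i : ι) (v : E i) :
    T x (tangentSingle x i v) = lam i x • tangentSingle x i v := by
  have hmem := tangentSingle_mem_productNet x i v
  rwa [← h.eigenspace_eq, Module.End.mem_eigenspace_iff] at hmem

theorem apply_eq_sum (h : IsAdaptedToEigenspaces T lam) (x : ∀ i, M i)
    (v : TangentSpace (piModel E) x) :
    T x v = ∑ i, lam i x • tangentSingle x i (tangentProj x i v) := by
  conv_lhs => rw [← sum_tangentSingle x v, map_sum]
  exact Finset.sum_congr rfl fun i _ ↦ h.apply_tangentSingle x i _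

end IsAdaptedToEigenspaces

variable [DecidableEq ι] [∀ i, IsManifold 𝓘(ℝ, E i) ∞ (M i)]

/-- The factors of the product are mutually orthogonal. -/
def PseudoRiemannianMetric.IsBlockDiagonal (g : PseudoRiemannianMetric (piModel E) (∀ i, M i)) :
    Prop :=
  ∀ (x : ∀ i, M i) (i j : ι), i ≠ j → ∀ (v : E i) (w : E j),
    g.inner x (tangentSingle x i v) (tangentSingle x j w) = 0

theorem IsAdaptedToEigenspaces.isBlockDiagonal {g : PseudoRiemannianMetric (piModel E) (∀ i, M i)}
    {T : (x : ∀ i, M i) → TangentSpace (piModel E) x →L[ℝ] TangentSpace (piModel E) x}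
    {lam : ι → (∀ i, M i) → ℝ} (h : IsAdaptedToEigenspaces T lam) (hT : IsOrthogonalTensor g T) :
    g.IsBlockDiagonal := by
  intro x i j hij v w
  have hself := hT.selfAdjoint x (tangentSingle x i v) (tangentSingle x j w)
  simp only [h.apply_tangentSingle, map_smul, smul_apply, smul_eq_mul] at hself
  have hmul : (lam i x - lam j x) * g.inner x (tangentSingle x i v) (tangentSingle x j w) = 0 := by
    rw [sub_mul, hself, sub_self]
  exact (mul_eq_zero.1 hmul).resolve_left (sub_ne_zero.2 (h.lam_ne x hij))

namespace PseudoRiemannianMetric.IsBlockDiagonal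

variable {g : PseudoRiemannianMetric (piModel E) (∀ i, M i)}

theorem inner_tangentSingle_left (hg : g.IsBlockDiagonal) (x : ∀ i, M i) (i : ι) (v : E i)
    (w : TangentSpace (piModel E) x) :
    g.inner x (tangentSingle x i v) w =
      g.inner x (tangentSingle x i v) (tangentSingle x i (tangentProj x i w)) := by
  conv_lhs => rw [← sum_tangentSingle x w, map_sum]
  exact Finset.sum_eq_single i (fun j _ hj ↦ hg x i j hj.symm v _) (by simp)

theorem inner_eq_sum (hg : g.IsBlockDiagonal) (x : ∀ i, M i) (v w : TangentSpace (piModel E) x) :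
    g.inner x v w = ∑ i, g.inner x (tangentSingle x i (tangentProj x i v))
      (tangentSingle x i (tangentProj x i w)) := by
  conv_lhs => rw [← sum_tangentSingle x v, map_sum, sum_apply]
  exact Finset.sum_congr rfl fun i _ ↦ hg.inner_tangentSingle_left x i _ w

theorem nondegenerate_block (hg : g.IsBlockDiagonal) (x : ∀ i, M i) (i : ι) (v : E i)
    (h : ∀ w : E i, g.inner x (tangentSingle x i v) (tangentSingle x i w) = 0) : v = 0 := by
  have hsingle : tangentSingle x i v = 0 := by
    refine g.nondegenerate x _ fun w ↦ ?_
    rw [hg.inner_tangentSingle_left, h]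
  rw [← tangentProj_tangentSingle_self x i v, hsingle, map_zero]

theorem exists_inner_self_ne_zero {i : ι} [Nontrivial (E i)] (hg : g.IsBlockDiagonal)
    (x : ∀ i, M i) :
    ∃ v : E i, g.inner x (tangentSingle x i v) (tangentSingle x i v) ≠ 0 := by
  by_contra! h
  obtain ⟨v, hv⟩ := exists_ne (0 : E i)
  refine hv (hg.nondegenerate_block x i v fun w ↦ ?_)
  have hadd := h (v + w)
  simp only [map_add, add_apply] at hadd
  rw [h v, h w, g.symm x (tangentSingle x i w) (tangentSingle x i v)] at hadd
  linarith

theorem mem_orthogonal_productNet (hg : g.IsBlockDiagonal) {x : ∀ i, M i} {i : ι}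
    {v : TangentSpace (piModel E) x} (hv : tangentProj x i v = 0) :
    v ∈ (g.form x).orthogonal (productNet i x) := by
  rw [LinearMap.BilinForm.mem_orthogonal_iff]
  intro w hw
  change g.inner x w v = 0
  rw [← tangentSingle_tangentProj_of_mem hw, hg.inner_tangentSingle_left, hv, map_zero, map_zero]

theorem isCompl_productNet (hg : g.IsBlockDiagonal) (x : ∀ i, M i) (i : ι) :
    IsCompl (productNet i x) ((g.form x).orthogonal (productNet i x)) := by
  constructor
  · rw [Submodule.disjoint_def]
    intro v hv hvperp
    rw [LinearMap.BilinForm.mem_orthogonal_iff] at hvperp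
    have hproj : tangentProj x i v = 0 := by
      refine hg.nondegenerate_block x i _ fun w ↦ ?_
      rw [tangentSingle_tangentProj_of_mem hv, g.symm]
      exact hvperp _ (tangentSingle_mem_productNet x i w)
    rw [← tangentSingle_tangentProj_of_mem hv, hproj, map_zero]
  · rw [codisjoint_iff, eq_top_iff]
    intro v _
    rw [Submodule.mem_sup]
    exact ⟨tangentSingle x i (tangentProj x i v), tangentSingle_mem_productNet x i _,
      v - tangentSingle x i (tangentProj x i v), hg.mem_orthogonal_productNet (by simp), by simp⟩

theorem orthProj_productNet (hg : g.IsBlockDiagonal) (x : ∀ i, M i) (i : ι)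
    (v : TangentSpace (piModel E) x) :
    g.orthProj x (productNet i x) v = tangentSingle x i (tangentProj x i v) := by
  rw [PseudoRiemannianMetric.orthProj, dif_pos (hg.isCompl_productNet x i)]
  have hperp : v - tangentSingle x i (tangentProj x i v) ∈
      (g.form x).orthogonal (productNet i x) := hg.mem_orthogonal_productNet (by simp)
  conv_lhs => rw [← add_sub_cancel (tangentSingle x i (tangentProj x i v)) v, map_add]
  rw [Submodule.projection_apply_of_mem_left _ (tangentSingle_mem_productNet x i _),
    Submodule.projection_apply_of_mem_right _ hperp, add_zero]

theorem tangentProj_eq_iff (hg : g.IsBlockDiagonal) {x : ∀ i, M i} {i : ι}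
    {u w : TangentSpace (piModel E) x} :
    tangentProj x i u = tangentProj x i w ↔
      ∀ v : E i, g.inner x u (tangentSingle x i v) = g.inner x w (tangentSingle x i v) := by
  have hinner (u : TangentSpace (piModel E) x) (v : E i) :
      g.inner x u (tangentSingle x i v) =
        g.inner x (tangentSingle x i (tangentProj x i u)) (tangentSingle x i v) := by
    rw [g.symm, hg.inner_tangentSingle_left, g.symm]
  refine ⟨fun h v ↦ by rw [hinner, h, ← hinner], fun h ↦ sub_eq_zero.1 ?_⟩
  rw [← map_sub]
  refine hg.nondegenerate_block x i _ fun v ↦ ?_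
  rw [← hinner, map_sub, sub_apply, h v, sub_self]

theorem perpProj_eq_smul_sum_orthProj_iff (hg : g.IsBlockDiagonal) (x : ∀ i, M i) (i : ι) (c : ℝ)
    (u : TangentSpace (piModel E) x) (w : ι → TangentSpace (piModel E) x) :
    g.perpProj x (productNet i x) u =
        c • ∑ j ∈ Finset.univ.erase i, g.orthProj x (productNet j x) (w j) ↔
      ∀ j, j ≠ i → tangentProj x j u = c • tangentProj x j (w j) := by
  have hperp (j : ι) : tangentProj x j (u - tangentSingle x i (tangentProj x i u)) =
      if j ∈ Finset.univ.erase i then tangentProj x j u else 0 := by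
    by_cases hj : j = i
    · subst hj; simp
    · simp [tangentProj_tangentSingle_of_ne x hj, hj]
  simp only [PseudoRiemannianMetric.perpProj, hg.orthProj_productNet]
  constructor
  · intro heq j hj
    have hmem : j ∈ Finset.univ.erase i := Finset.mem_erase.2 ⟨hj, Finset.mem_univ j⟩
    have hproj := congrArg (tangentProj x j) heq
    rwa [map_smul, hperp, tangentProj_sum_tangentSingle, if_pos hmem, if_pos hmem] at hproj
  · intro heq
    apply tangent_ext
    intro j
    rw [map_smul, hperp, tangentProj_sum_tangentSingle]
    split_ifs with hj
    · exact heq j (Finset.ne_of_mem_erase hj)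
    · rw [smul_zero]

variable [∀ i, FiniteDimensional ℝ (E i)]

theorem perpProj_grad_eq_iff (hg : g.IsBlockDiagonal) (x : ∀ i, M i) (i : ι) (c : ℝ)
    (f : (∀ i, M i) → ℝ) (h : ι → (∀ i, M i) → ℝ) :
    g.perpProj x (productNet i x) (g.grad f x) =
        c • ∑ j ∈ Finset.univ.erase i, g.orthProj x (productNet j x) (g.grad (h j) x) ↔
      ∀ j, j ≠ i → ∀ v : E j, mvfderiv (piModel E) f x (tangentSingle x j v) =
        c * mvfderiv (piModel E) (h j) x (tangentSingle x j v) := by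
  rw [hg.perpProj_eq_smul_sum_orthProj_iff]
  refine forall₂_congr fun j _ ↦ ?_
  rw [← map_smul, hg.tangentProj_eq_iff]
  refine forall_congr' fun v ↦ ?_
  rw [map_smul, smul_apply, g.inner_grad, g.inner_grad, smul_eq_mul]

end PseudoRiemannianMetric.IsBlockDiagonal

end BlockDiagonal

section PartialDerivatives

variable {ι : Type*} {E : ι → Type*} [∀ i, NormedAddCommGroup (E i)]
  [∀ i, NormedSpace ℝ (E i)] {M : ι → Type*} [∀ i, TopologicalSpace (M i)]
  [∀ i, ChartedSpace (E i) (M i)] {F : Type*} [NormedAddCommGroup F] [NormedSpace ℝ F]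
  [DecidableEq ι]

variable (E) in
/-- The differential of `f` along the slice of the `i`-th factor through `x`. -/
def partialDeriv (i : ι) (f : (∀ i, M i) → F) (x : ∀ i, M i) : E i →L[ℝ] F :=
  mvfderiv 𝓘(ℝ, E i) (fun y ↦ f (Function.update x i y)) (x i)

theorem partialDeriv_update (f : (∀ i, M i) → F) (x : ∀ i, M i) (i : ι) (y : M i) (a : E i) :
    partialDeriv E i f (Function.update x i y) a =
      mvfderiv 𝓘(ℝ, E i) (fun z ↦ f (Function.update x i z)) y a := by
  simp only [partialDeriv, Function.update_idem]
  rw [Function.update_self]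
  rfl

theorem mvfderiv_tangentSingle [Fintype ι] {f : (∀ i, M i) → F} {x : ∀ i, M i}
    (hf : MDifferentiableAt (piModel E) 𝓘(ℝ, F) f x) (i : ι) (a : E i) :
    mvfderiv (piModel E) f x (tangentSingle x i a) = partialDeriv E i f x a := by
  have hslice : MDifferentiableAt 𝓘(ℝ, E i) (piModel E)
      (fun y : M i ↦ Function.update x i y) (x i) :=
    (contMDiff_update (n := 1) x i).mdifferentiable one_ne_zero (x i)
  have hchain : mvfderiv (piModel E) f (Function.update x i (x i))
      (tangentSingle (Function.update x i (x i)) i a) = partialDeriv E i f x a := by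
    have hcomp := mfderiv_comp_of_eq hf hslice (Function.update_eq_self i x)
    exact ((congrArg (fun L ↦ L a) hcomp).trans
      (congrArg (mvfderiv (piModel E) f _) (mfderiv_update x i (x i) a))).symm
  rwa [Function.update_eq_self] at hchain

theorem partialDeriv_sub [Fintype ι] {f f' : (∀ i, M i) → F} {x : ∀ i, M i}
    (hf : MDifferentiableAt (piModel E) 𝓘(ℝ, F) f x)
    (hf' : MDifferentiableAt (piModel E) 𝓘(ℝ, F) f' x) (i : ι) :
    partialDeriv E i (fun y ↦ f y - f' y) x = partialDeriv E i f x - partialDeriv E i f' x := by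
  ext a
  rw [← mvfderiv_tangentSingle (f := fun y ↦ f y - f' y) (hf.sub hf'), sub_apply,
    ← mvfderiv_tangentSingle hf, ← mvfderiv_tangentSingle hf', mvfderiv_fun_sub hf hf']
  rfl

end PartialDerivatives

section MetricBlocks

variable {ι : Type*} [Fintype ι] {E : ι → Type*} [∀ i, NormedAddCommGroup (E i)]
  [∀ i, NormedSpace ℝ (E i)] {M : ι → Type*} [∀ i, TopologicalSpace (M i)]
  [∀ i, ChartedSpace (E i) (M i)] [∀ i, IsManifold 𝓘(ℝ, E i) ∞ (M i)]

theorem IsAdaptedToEigenspaces.contMDiff_lam {g : PseudoRiemannianMetric (piModel E) (∀ i, M i)}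
    {T : (x : ∀ i, M i) → TangentSpace (piModel E) x →L[ℝ] TangentSpace (piModel E) x}
    {lam : ι → (∀ i, M i) → ℝ} (h : IsAdaptedToEigenspaces T lam) (hT : IsOrthogonalTensor g T)
    (i : ι) : ContMDiff (piModel E) 𝓘(ℝ, ℝ) ∞ (lam i) := by
  classical
  intro x
  have : Nonempty (∀ i, M i) := ⟨x⟩
  have := h.nontrivial i
  obtain ⟨v, hv⟩ := exists_ne (0 : E i)
  obtain ⟨ℓ, hℓ⟩ := SeparatingDual.exists_eq_one (R := ℝ) hv
  have hTframe : ContMDiffAt (piModel E) (piModel E).tangent ∞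
      (fun y ↦ (⟨y, T y (chartFrame (piModel E) x y (Pi.single i v))⟩ :
        TangentBundle (piModel E) (∀ i, M i))) x :=
    (hT.contMDiff x).clm_bundle_apply (contMDiffAt_chartFrame (mem_chart_source _ x) _)
  let ℓi : (∀ i, E i) →L[ℝ] ℝ := ℓ.comp (ContinuousLinearMap.proj i)
  refine (ℓi.contMDiff.contMDiffAt.comp x
    (contMDiffAt_vectorField_iff.1 hTframe)).congr_of_eventuallyEq ?_
  filter_upwards [chart_source_mem_nhds (ModelPi E) x] with y hy
  have heigen : T y (chartFrame (piModel E) x y (Pi.single i v)) =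
      lam i y • chartFrame (piModel E) x y (Pi.single i v) := by
    rw [chartFrame_single hy]
    exact h.apply_tangentSingle y i _
  simp [ℓi, heigen, chartCoframe_chartFrame hy, hℓ]

variable [DecidableEq ι]

namespace PseudoRiemannianMetric

variable (g : PseudoRiemannianMetric (piModel E) (∀ i, M i))

/-- The quadratic form of the `j`-th block of the metric at the fixed vector `v` of the model space.
Since `v` is read in the preferred chart at `x j`, this is a meaningful function of `x` only as long
as `x j` is kept fixed. -/
def blockQuad (j : ι) (v : E j) (x : ∀ i, M i) : ℝ :=
  g.inner x (tangentSingle x j v) (tangentSingle x j v)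

theorem blockQuad_neg (j : ι) (v : E j) : g.blockQuad j (-v) = g.blockQuad j v := by
  ext x
  simp only [blockQuad, map_neg, neg_apply, neg_neg]

theorem blockQuad_zero (j : ι) : g.blockQuad j (0 : E j) = 0 := by
  ext x
  simp [blockQuad]

theorem blockQuad_update_eventuallyEq (x : ∀ i, M i) {i j : ι} (hij : i ≠ j) (v : E j) :
    (fun y ↦ g.blockQuad j v (Function.update x i y)) =ᶠ[𝓝 (x i)]
      fun y ↦ g.coord x (Function.update x i y) (Pi.single j v) (Pi.single j v) := by
  filter_upwards [chart_source_mem_nhds (E i) (x i)] with y hy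
  have hframe : chartFrame (piModel E) x (Function.update x i y) (Pi.single j v) =
      tangentSingle (Function.update x i y) j v := by
    rw [chartFrame_single (update_mem_chartAt_pi_source hy), Function.update_of_ne hij.symm]
    exact congrArg _ (chartFrame_self (x j) v)
  rw [blockQuad, coord_apply, hframe]

theorem contMDiff_blockQuad_update (x : ∀ i, M i) {i j : ι} (hij : i ≠ j) (v : E j) :
    ContMDiff 𝓘(ℝ, E i) 𝓘(ℝ, ℝ) ∞ (fun y ↦ g.blockQuad j v (Function.update x i y)) := by
  have hbase (x : ∀ i, M i) : ContMDiffAt 𝓘(ℝ, E i) 𝓘(ℝ, ℝ) ∞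
      (fun y ↦ g.blockQuad j v (Function.update x i y)) (x i) :=
    ((g.contMDiffAt_coord_apply x _ _).comp_of_eq (contMDiff_update x i (x i))
      (Function.update_eq_self i x)).congr_of_eventuallyEq (g.blockQuad_update_eventuallyEq x hij v)
  intro y
  simpa only [Function.update_idem, Function.update_self] using hbase (Function.update x i y)

theorem partialDeriv_blockQuad (x : ∀ i, M i) {i j : ι} (hij : i ≠ j) (v : E j) (a : E i) :
    partialDeriv E i (g.blockQuad j v) x a =
      mvfderiv (piModel E) (fun y ↦ g.coord x y (Pi.single j v) (Pi.single j v)) x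
        (tangentSingle x i a) := by
  rw [mvfderiv_tangentSingle ((g.contMDiffAt_coord_apply x _ _).mdifferentiableAt (by simp))]
  exact mvfderiv_congr_of_eventuallyEq (g.blockQuad_update_eventuallyEq x hij v) a

end PseudoRiemannianMetric

end MetricBlocks

section Bracket

theorem sum_antisymm_mul_symm {ι : Type*} [Fintype ι] (l : ι → ℝ) (h : ι → ι → ℝ)
    (hsymm : ∀ i j, h i j = h j i) : ∑ i, ∑ j, (l i - l j) * h i j = 0 := by
  have hswap : ∑ i, ∑ j, l j * h i j = ∑ i, ∑ j, l i * h i j := by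
    rw [Finset.sum_comm]
    simp_rw [hsymm]
  simp only [sub_mul, Finset.sum_sub_distrib, hswap, sub_self]

variable {ι : Type*} [Fintype ι] [DecidableEq ι] {E : ι → Type*} [∀ i, NormedAddCommGroup (E i)]
  [∀ i, NormedSpace ℝ (E i)] {M : ι → Type*} [∀ i, TopologicalSpace (M i)]
  [∀ i, ChartedSpace (E i) (M i)] [∀ i, IsManifold 𝓘(ℝ, E i) ∞ (M i)]
  {g : PseudoRiemannianMetric (piModel E) (∀ i, M i)}

theorem PseudoRiemannianMetric.IsBlockDiagonal.coord_single_apply (hg : g.IsBlockDiagonal)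
    {x y : ∀ i, M i} (hy : y ∈ (chartAt (ModelPi E) x).source) (j : ι) (v : ∀ i, E i) (w : E j) :
    g.coord x y (Pi.single j (v j)) (Pi.single j w) = g.coord x y v (Pi.single j w) := by
  rw [g.coord_apply, g.coord_apply, chartFrame_single_apply hy, chartFrame_single hy, g.symm]
  exact (hg.inner_tangentSingle_left y j _ _).symm.trans (g.symm y _ _)

/-- The `(i, j)` summand of `bracketForm`. -/
def bracketTerm (g : PseudoRiemannianMetric (piModel E) (∀ i, M i)) (lam : ι → (∀ i, M i) → ℝ)
    (x : ∀ i, M i) (i j : ι) (a : E i) (v : E j) : ℝ :=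
  (lam i x - lam j x) * partialDeriv E i (g.blockQuad j v) x a +
    g.blockQuad j v x * partialDeriv E i (lam j) x a

/-- The cubic form `∑ (λ_i - λ_j) ∂_{X_i} g_j (X_j, X_j) + g_j (X_j, X_j) dλ_j (X_i)` to which the
Schouten bracket `[T, G]` amounts. The derivatives of `g_j` along the `j`-th factor depend on the
charts, but occur only with the coefficient `λ_j - λ_j = 0`. -/
def bracketForm (g : PseudoRiemannianMetric (piModel E) (∀ i, M i)) (lam : ι → (∀ i, M i) → ℝ)
    (x : ∀ i, M i) (X : TangentSpace (piModel E) x) : ℝ :=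
  ∑ i, ∑ j, bracketTerm g lam x i j (tangentProj x i X) (tangentProj x j X)

variable [∀ i, FiniteDimensional ℝ (E i)]

namespace PseudoRiemannianMetric

variable (g) {f : (∀ i, M i) → ℝ} {x : ∀ i, M i}

/-- The part of `G(df, df)` belonging to the `j`-th factor. -/
def blockNorm (f : (∀ i, M i) → ℝ) (j : ι) (y : ∀ i, M i) : ℝ :=
  g.blockQuad j (tangentProj y j (g.grad f y)) y

theorem chartFrame_single_gradCoord {x y : ∀ i, M i} (hy : y ∈ (chartAt (ModelPi E) x).source)
    (f : (∀ i, M i) → ℝ) (j : ι) :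
    chartFrame (piModel E) x y (Pi.single j (g.gradCoord f x y j)) =
      tangentSingle y j (tangentProj y j (g.grad f y)) := by
  rw [chartFrame_single_apply hy, gradCoord, chartFrame_chartCoframe hy]

theorem contMDiffAt_single_gradCoord (hf : ContMDiffAt (piModel E) 𝓘(ℝ, ℝ) ∞ f x) (j : ι) :
    ContMDiffAt (piModel E) 𝓘(ℝ, ∀ i, E i) ∞
      (fun y ↦ (Pi.single j (g.gradCoord f x y j) : ∀ i, E i)) x := by
  let P : (∀ i, E i) →L[ℝ] ∀ i, E i :=
    (ContinuousLinearMap.single ℝ E j).comp (ContinuousLinearMap.proj j)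
  exact P.contMDiff.contMDiffAt.comp x (g.contMDiffAt_gradCoord hf)

theorem blockNorm_eventuallyEq (f : (∀ i, M i) → ℝ) (x : ∀ i, M i) (j : ι) :
    g.blockNorm f j =ᶠ[𝓝 x] fun y ↦ g.coord x y (Pi.single j (g.gradCoord f x y j))
      (Pi.single j (g.gradCoord f x y j)) := by
  filter_upwards [chart_source_mem_nhds (ModelPi E) x] with y hy
  rw [g.coord_apply, g.chartFrame_single_gradCoord hy]
  rfl

theorem mdifferentiableAt_blockNorm (hf : ContMDiffAt (piModel E) 𝓘(ℝ, ℝ) ∞ f x) (j : ι) :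
    MDifferentiableAt (piModel E) 𝓘(ℝ, ℝ) (g.blockNorm f j) x := by
  have hgrad := (g.contMDiffAt_single_gradCoord hf j).mdifferentiableAt (by simp)
  exact ((((g.contMDiffAt_coord x).mdifferentiableAt (by simp)).clm_apply hgrad).clm_apply
    hgrad).congr_of_eventuallyEq (g.blockNorm_eventuallyEq f x j)

end PseudoRiemannianMetric

variable {T : (x : ∀ i, M i) → TangentSpace (piModel E) x →L[ℝ] TangentSpace (piModel E) x}
  {lam : ι → (∀ i, M i) → ℝ} {f : (∀ i, M i) → ℝ} {x : ∀ i, M i}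

namespace PseudoRiemannianMetric.IsBlockDiagonal

theorem mvfderiv_tangentSingle_grad (hg : g.IsBlockDiagonal) (f : (∀ i, M i) → ℝ) (j : ι)
    (y : ∀ i, M i) :
    mvfderiv (piModel E) f y (tangentSingle y j (tangentProj y j (g.grad f y))) =
      g.blockNorm f j y := by
  rw [← g.inner_grad, g.symm, hg.inner_tangentSingle_left]
  rfl

theorem contravariant_mvfderiv (hg : g.IsBlockDiagonal) (f : (∀ i, M i) → ℝ) (y : ∀ i, M i) :
    g.contravariant y (mvfderiv (piModel E) f y) (mvfderiv (piModel E) f y) =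
      ∑ j, g.blockNorm f j y := by
  change mvfderiv (piModel E) f y (g.grad f y) = _
  conv_lhs => rw [← sum_tangentSingle y (g.grad f y), map_sum]
  exact Finset.sum_congr rfl fun j _ ↦ hg.mvfderiv_tangentSingle_grad f j y

theorem raise_mvfderiv (hg : g.IsBlockDiagonal) (hadapted : IsAdaptedToEigenspaces T lam)
    (f : (∀ i, M i) → ℝ) (y : ∀ i, M i) :
    g.raise T y (mvfderiv (piModel E) f y) (mvfderiv (piModel E) f y) =
      ∑ j, lam j y * g.blockNorm f j y := by
  change mvfderiv (piModel E) f y (T y (g.grad f y)) = _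
  rw [hadapted.apply_eq_sum, map_sum]
  refine Finset.sum_congr rfl fun j _ ↦ ?_
  rw [map_smul, hg.mvfderiv_tangentSingle_grad, smul_eq_mul]

theorem mvfderiv_blockNorm (hg : g.IsBlockDiagonal) (hf : ContMDiffAt (piModel E) 𝓘(ℝ, ℝ) ∞ f x)
    (j : ι) (a : TangentSpace (piModel E) x) :
    mvfderiv (piModel E) (g.blockNorm f j) x a =
      2 * coordHessian (piModel E) f x a (Pi.single j (tangentProj x j (g.grad f x))) -
        mvfderiv (piModel E) (fun y ↦ g.coord x y (Pi.single j (tangentProj x j (g.grad f x)))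
          (Pi.single j (tangentProj x j (g.grad f x)))) x a := by
  have hX : g.gradCoord f x x j = tangentProj x j (g.grad f x) :=
    congrArg (tangentProj x j) (g.gradCoord_self f x)
  have hpair (w : E j) : (fun y ↦ g.coord x y (Pi.single j (g.gradCoord f x y j)) (Pi.single j w))
      =ᶠ[𝓝 x] fun y ↦ diffCoord (piModel E) f x y (Pi.single j w) := by
    filter_upwards [chart_source_mem_nhds (ModelPi E) x] with y hy
    rw [hg.coord_single_apply hy, g.coord_gradCoord f hy]
  rw [mvfderiv_congr_of_eventuallyEq (g.blockNorm_eventuallyEq f x j),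
    mvfderiv_bilin_apply_self ((g.contMDiffAt_coord x).mdifferentiableAt (by simp))
      ((g.contMDiffAt_single_gradCoord hf j).mdifferentiableAt (by simp)) (g.coord_symm x x), hX,
    mvfderiv_congr_of_eventuallyEq (hpair _),
    mvfderiv_clm_apply_const ((contMDiffAt_diffCoord hf).mdifferentiableAt (by simp))]
  rfl

end PseudoRiemannianMetric.IsBlockDiagonal

theorem schoutenBracket_eq_sum_mvfderiv_blockNorm (hT : IsOrthogonalTensor g T)
    (hadapted : IsAdaptedToEigenspaces T lam)
    (hf : ContMDiffAt (piModel E) 𝓘(ℝ, ℝ) ∞ f x) :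
    schoutenBracket (I := piModel E) (g.raise T) g.contravariant f x =
      2 * ∑ i, ∑ j, ((lam i x - lam j x) * mvfderiv (piModel E) (g.blockNorm f j) x
          (tangentSingle x i (tangentProj x i (g.grad f x))) -
        g.blockNorm f j x * mvfderiv (piModel E) (lam j) x
          (tangentSingle x i (tangentProj x i (g.grad f x)))) := by
  have hg := hadapted.isBlockDiagonal hT
  have hnorm (j : ι) : MDifferentiableAt (piModel E) 𝓘(ℝ, ℝ) (g.blockNorm f j) x :=
    g.mdifferentiableAt_blockNorm hf j
  have hlam (j : ι) : MDifferentiableAt (piModel E) 𝓘(ℝ, ℝ) (lam j) x :=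
    (hadapted.contMDiff_lam hT j x).mdifferentiableAt (by simp)
  have hG (a : TangentSpace (piModel E) x) :
      mvfderiv (piModel E) (fun y ↦ ∑ j, g.blockNorm f j y) x a =
        ∑ j, mvfderiv (piModel E) (g.blockNorm f j) x a := by
    rw [mvfderiv_fun_sum fun j _ ↦ hnorm j, sum_apply]
  have hK (a : TangentSpace (piModel E) x) :
      mvfderiv (piModel E) (fun y ↦ ∑ j, lam j y * g.blockNorm f j y) x a =
        ∑ j, (lam j x * mvfderiv (piModel E) (g.blockNorm f j) x a +
          g.blockNorm f j x * mvfderiv (piModel E) (lam j) x a) := by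
    rw [mvfderiv_fun_sum (f := fun j y ↦ lam j y * g.blockNorm f j y)
      fun j _ ↦ (hlam j).mul (hnorm j), sum_apply]
    refine Finset.sum_congr rfl fun j _ ↦ ?_
    rw [mvfderiv_fun_mul (hlam j) (hnorm j)]
    rfl
  simp only [schoutenBracket, hg.contravariant_mvfderiv, hg.raise_mvfderiv hadapted]
  rw [g.raise_apply (hT.selfAdjoint x), g.contravariant_apply]
  change 2 * (mvfderiv (piModel E) _ x (T x (g.grad f x)) -
    mvfderiv (piModel E) _ x (g.grad f x)) = _
  rw [hadapted.apply_eq_sum, map_sum]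
  conv_lhs => enter [2, 2]; rw [← sum_tangentSingle x (g.grad f x), map_sum]
  simp only [map_smul, hG, hK, smul_eq_mul, Finset.mul_sum, ← Finset.sum_sub_distrib]
  refine Finset.sum_congr rfl fun i _ ↦ Finset.sum_congr rfl fun j _ ↦ ?_
  ring

theorem schoutenBracket_eq_bracketForm (hT : IsOrthogonalTensor g T)
    (hadapted : IsAdaptedToEigenspaces T lam) (hf : ContMDiffAt (piModel E) 𝓘(ℝ, ℝ) ∞ f x) :
    schoutenBracket (I := piModel E) (g.raise T) g.contravariant f x =
      -2 * bracketForm g lam x (g.grad f x) := by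
  let X (i : ι) : TangentSpace (piModel E) x := tangentSingle x i (tangentProj x i (g.grad f x))
  have hhess : ∑ i, ∑ j, (lam i x - lam j x) * coordHessian (piModel E) f x (X i) (X j) = 0 :=
    sum_antisymm_mul_symm _ _ fun i j ↦ coordHessian_symm hf (X i) (X j)
  have hterm (i j : ι) : (lam i x - lam j x) * mvfderiv (piModel E) (g.blockNorm f j) x (X i) -
      g.blockNorm f j x * mvfderiv (piModel E) (lam j) x (X i) =
        2 * ((lam i x - lam j x) * coordHessian (piModel E) f x (X i) (X j)) -
          bracketTerm g lam x i j (tangentProj x i (g.grad f x))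
            (tangentProj x j (g.grad f x)) := by
    have hlam : mvfderiv (piModel E) (lam j) x (X i) = partialDeriv E i (lam j) x _ :=
      mvfderiv_tangentSingle ((hadapted.contMDiff_lam hT j x).mdifferentiableAt (by simp)) i _
    have hnorm : mvfderiv (piModel E) (g.blockNorm f j) x (X i) =
        2 * coordHessian (piModel E) f x (X i) (X j) -
          mvfderiv (piModel E) (fun y ↦ g.coord x y (X j) (X j)) x (X i) :=
      (hadapted.isBlockDiagonal hT).mvfderiv_blockNorm hf j (X i)
    rw [hnorm, hlam, bracketTerm, ← PseudoRiemannianMetric.blockNorm]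
    obtain rfl | hij := eq_or_ne i j
    · ring
    · have hquad : partialDeriv E i (g.blockQuad j (tangentProj x j (g.grad f x))) x _ =
          mvfderiv (piModel E) (fun y ↦ g.coord x y (X j) (X j)) x (X i) :=
        g.partialDeriv_blockQuad x hij _ _
      rw [hquad]
      ring
  rw [schoutenBracket_eq_sum_mvfderiv_blockNorm hT hadapted hf]
  simp only [X] at hterm hhess
  simp only [hterm, Finset.sum_sub_distrib, ← Finset.mul_sum, hhess, bracketForm]
  ring

theorem isConformalKilling_iff_bracketForm (hT : IsOrthogonalTensor g T)
    (hadapted : IsAdaptedToEigenspaces T lam) :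
    IsConformalKilling g T ↔ ∃ C : (x : ∀ i, M i) → TangentSpace (piModel E) x,
      ContMDiff (piModel E) (piModel E).tangent ∞
        (fun x ↦ (⟨x, C x⟩ : TangentBundle (piModel E) (∀ i, M i))) ∧
      ∀ x (X : TangentSpace (piModel E) x),
        bracketForm g lam x X = g.inner x X (C x) * g.inner x X X := by
  have hright (C : (x : ∀ i, M i) → TangentSpace (piModel E) x) (x : ∀ i, M i)
      (f : (∀ i, M i) → ℝ) : mvfderiv (piModel E) f x (C x) *
        g.contravariant x (mvfderiv (piModel E) f x) (mvfderiv (piModel E) f x) =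
      g.inner x (g.grad f x) (C x) * g.inner x (g.grad f x) (g.grad f x) := by
    rw [g.inner_grad, g.inner_grad]
    rfl
  refine exists_congr fun C ↦ and_congr_right fun _ ↦ ⟨fun hC x X ↦ ?_, fun hC x f hf ↦ ?_⟩
  · obtain ⟨f, hf, rfl⟩ := g.exists_grad_eq x X
    have hbracket := hC x f hf
    rw [schoutenBracket_eq_bracketForm hT hadapted hf, hright] at hbracket
    exact mul_left_cancel₀ (by norm_num) hbracket
  · rw [schoutenBracket_eq_bracketForm hT hadapted hf, hright, hC]

end Bracket

section CubicForms

theorem linearMap_eq_zero_of_mul_quadratic_eq_zero {V : Type*} [AddCommGroup V] [Module ℝ V]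
    (ℓ : V →ₗ[ℝ] ℝ) (B : V →ₗ[ℝ] V →ₗ[ℝ] ℝ) (hB : ∃ v, B v v ≠ 0)
    (h : ∀ v, ℓ v * B v v = 0) : ℓ = 0 := by
  obtain ⟨v, hv⟩ := hB
  have hℓv : ℓ v = 0 := (mul_eq_zero.1 (h v)).resolve_right hv
  by_contra hℓ
  obtain ⟨a, ha⟩ := DFunLike.ne_iff.1 hℓ
  have hline (t : ℝ) : B (a + t • v) (a + t • v) = 0 :=
    (mul_eq_zero.1 (h _)).resolve_left (by simpa [hℓv] using ha)
  have hzero := hline 0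
  have hone := hline 1
  have hneg := hline (-1)
  simp only [map_add, map_smul, LinearMap.add_apply, LinearMap.smul_apply,
    smul_eq_mul] at hzero hone hneg
  exact hv (by linarith)

variable {ι : Type*} [Fintype ι] {E : ι → Type*} [∀ i, AddCommGroup (E i)]
  {s : ∀ i j, E i → E j → ℝ}

theorem sum_sum_single_add_single [DecidableEq ι] (hleft : ∀ i j v, s i j 0 v = 0)
    (hright : ∀ i j a, s i j a 0 = 0) {i j : ι} (hij : i ≠ j) (a : E i) (v : E j) :
    ∑ k, ∑ l, s k l ((Pi.single i a + Pi.single j v : ∀ i, E i) k)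
      ((Pi.single i a + Pi.single j v : ∀ i, E i) l) =
        s i i a a + s i j a v + (s j i v a + s j j v v) := by
  let X : ∀ i, E i := Pi.single i a + Pi.single j v
  have hi : X i = a := by simp [X, hij]
  have hj : X j = v := by simp [X, hij.symm]
  have hrest (k : ι) (hk : k ≠ i ∧ k ≠ j) : X k = 0 := by simp [X, hk.1, hk.2]
  have hrow (k : ι) (b : E k) : ∑ l, s k l b (X l) = s k i b a + s k j b v := by
    rw [Finset.sum_eq_add i j hij (fun l _ hl ↦ by rw [hrest l hl, hright]) (by simp) (by simp),
      hi, hj]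
  change ∑ k, ∑ l, s k l (X k) (X l) = _
  rw [Finset.sum_eq_add i j hij _ (by simp) (by simp), hrow, hrow, hi, hj]
  intro k _ hk
  rw [hrow, hrest k hk, hleft, hleft, add_zero]

theorem eq_zero_of_sum_sum_eq_zero (hodd : ∀ i j a v, s i j (-a) v = -s i j a v)
    (heven : ∀ i j a v, s i j a (-v) = s i j a v) (hright : ∀ i j a, s i j a 0 = 0)
    (hsum : ∀ X : ∀ i, E i, ∑ i, ∑ j, s i j (X i) (X j) = 0) :
    (∀ i a, s i i a a = 0) ∧ ∀ i j, i ≠ j → ∀ a v, s i j a v = 0 := by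
  classical
  have hleft (i j : ι) (v : E j) : s i j 0 v = 0 :=
    self_eq_neg.1 (by simpa only [neg_zero] using hodd i j 0 v)
  have hdiag (i : ι) (a : E i) : s i i a a = 0 := by
    have h := hsum (Pi.single i a)
    rwa [Finset.sum_eq_single i, Finset.sum_eq_single i, Pi.single_eq_same] at h
    · intro k _ hk
      rw [Pi.single_eq_of_ne hk, hright]
    · simp
    · intro k _ hk
      simp only [Pi.single_eq_of_ne hk, hleft, Finset.sum_const_zero]
    · simp
  refine ⟨hdiag, fun i j hij a v ↦ ?_⟩
  -- Replacing `a` by `-a` separates the terms that are odd in `a` from the even ones.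
  have hpos := hsum (Pi.single i a + Pi.single j v)
  have hneg := hsum (Pi.single i (-a) + Pi.single j v)
  rw [sum_sum_single_add_single hleft hright hij, hdiag, hdiag] at hpos hneg
  rw [hodd, heven] at hneg
  linarith

end CubicForms

section KillingEquation

variable {ι : Type*} [Fintype ι] [DecidableEq ι] {E : ι → Type*} [∀ i, NormedAddCommGroup (E i)]
  [∀ i, NormedSpace ℝ (E i)] {M : ι → Type*} [∀ i, TopologicalSpace (M i)]
  [∀ i, ChartedSpace (E i) (M i)] [∀ i, IsManifold 𝓘(ℝ, E i) ∞ (M i)]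
  {g : PseudoRiemannianMetric (piModel E) (∀ i, M i)} {lam : ι → (∀ i, M i) → ℝ}

/-- Along the `i`-th factor the `j`-th block of the metric has the same logarithmic derivative as
`λ_i - λ_j`. -/
def BlockScaling (g : PseudoRiemannianMetric (piModel E) (∀ i, M i)) (lam : ι → (∀ i, M i) → ℝ) :
    Prop :=
  ∀ (x : ∀ i, M i) (i j : ι), i ≠ j → ∀ v : E j,
    (lam i x - lam j x) • partialDeriv E i (g.blockQuad j v) x =
      g.blockQuad j v x • partialDeriv E i (fun y ↦ lam i y - lam j y) x

theorem bracketTerm_neg_left (x : ∀ i, M i) (i j : ι) (a : E i) (v : E j) :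
    bracketTerm g lam x i j (-a) v = -bracketTerm g lam x i j a v := by
  simp only [bracketTerm, map_neg]
  ring

theorem bracketTerm_neg_right (x : ∀ i, M i) (i j : ι) (a : E i) (v : E j) :
    bracketTerm g lam x i j a (-v) = bracketTerm g lam x i j a v := by
  rw [bracketTerm, g.blockQuad_neg, bracketTerm]

theorem bracketTerm_zero_right (x : ∀ i, M i) (i j : ι) (a : E i) :
    bracketTerm g lam x i j a (0 : E j) = 0 := by
  have hderiv : partialDeriv E i (0 : (∀ i, M i) → ℝ) x = 0 := mvfderiv_const 0
  rw [bracketTerm, g.blockQuad_zero, hderiv]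
  simp

theorem bracketTerm_eq_of_bracketForm_eq (hg : g.IsBlockDiagonal) {x : ∀ i, M i}
    {C : TangentSpace (piModel E) x}
    (h : ∀ X, bracketForm g lam x X = g.inner x X C * g.inner x X X) :
    (∀ i a, bracketTerm g lam x i i a a =
        g.inner x (tangentSingle x i a) C * g.blockQuad i a x) ∧
      ∀ i j, i ≠ j → ∀ a v, bracketTerm g lam x i j a v =
        g.inner x (tangentSingle x i a) C * g.blockQuad j v x := by
  have hvanish := eq_zero_of_sum_sum_eq_zero (s := fun i j a v ↦ bracketTerm g lam x i j a v -
    g.inner x (tangentSingle x i a) C * g.blockQuad j v x) ?_ ?_ ?_ ?_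
  · simpa only [sub_eq_zero] using hvanish
  · intro i j a v
    simp only [bracketTerm_neg_left, map_neg, neg_apply]
    ring
  · intro i j a v
    simp only [bracketTerm_neg_right, g.blockQuad_neg]
  · intro i j a
    simp [bracketTerm_zero_right, g.blockQuad_zero]
  · intro X
    have hC : g.inner x (show TangentSpace (piModel E) x from X) C =
        ∑ i, g.inner x (tangentSingle x i (X i)) C := by
      conv_lhs => rw [← sum_tangentSingle x (show TangentSpace (piModel E) x from X)]
      rw [map_sum, sum_apply]
      rfl
    have hbracket := h X
    rw [hC, hg.inner_eq_sum x X X, Finset.sum_mul_sum] at hbracket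
    simp only [Finset.sum_sub_distrib]
    exact sub_eq_zero.2 hbracket

theorem partialDeriv_lam_of_bracketTerm_eq (hg : g.IsBlockDiagonal) {x : ∀ i, M i} {i : ι}
    [Nontrivial (E i)] {C : TangentSpace (piModel E) x}
    (h : ∀ a, bracketTerm g lam x i i a a = g.inner x (tangentSingle x i a) C * g.blockQuad i a x)
    (a : E i) : partialDeriv E i (lam i) x a = g.inner x (tangentSingle x i a) C := by
  let ℓ : E i →L[ℝ] ℝ := partialDeriv E i (lam i) x - (g.inner x C).comp (tangentSingle x i)
  let B : E i →ₗ[ℝ] E i →ₗ[ℝ] ℝ :=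
    (g.form x).compl₁₂ (tangentSingle x i).toLinearMap (tangentSingle x i).toLinearMap
  have hℓ (b : E i) : ℓ b = partialDeriv E i (lam i) x b - g.inner x (tangentSingle x i b) C := by
    rw [g.symm]
    rfl
  have hzero := linearMap_eq_zero_of_mul_quadratic_eq_zero ℓ.toLinearMap B
    (hg.exists_inner_self_ne_zero (i := i) x) fun b ↦ by
      have hterm := h b
      rw [bracketTerm, sub_self, zero_mul, zero_add] at hterm
      change ℓ b * g.blockQuad i b x = 0
      rw [hℓ, sub_mul, ← hterm]
      ring
  exact sub_eq_zero.1 ((hℓ a).symm.trans (DFunLike.congr_fun hzero a))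

theorem blockScaling_of_bracketForm_eq [∀ i, Nontrivial (E i)] (hg : g.IsBlockDiagonal)
    (hlam : ∀ i, ContMDiff (piModel E) 𝓘(ℝ, ℝ) ∞ (lam i))
    {C : (x : ∀ i, M i) → TangentSpace (piModel E) x}
    (h : ∀ x X, bracketForm g lam x X = g.inner x X (C x) * g.inner x X X) :
    BlockScaling g lam := by
  intro x i j hij v
  obtain ⟨hdiag, hoff⟩ := bracketTerm_eq_of_bracketForm_eq hg (h x)
  have hlam' (i : ι) := (hlam i x).mdifferentiableAt (by simp)
  ext a
  have hterm := hoff i j hij a v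
  rw [← partialDeriv_lam_of_bracketTerm_eq hg (hdiag i), bracketTerm] at hterm
  rw [partialDeriv_sub (hlam' i) (hlam' j)]
  simp only [smul_apply, sub_apply, smul_eq_mul]
  linarith

variable [∀ i, FiniteDimensional ℝ (E i)]

/-- The vector field `∑ (∇ λ_i)^i`, the only candidate for `C` in `[T, G] = -2 C ⊙ G`. -/
def blockGradient (g : PseudoRiemannianMetric (piModel E) (∀ i, M i)) (lam : ι → (∀ i, M i) → ℝ)
    (x : ∀ i, M i) : TangentSpace (piModel E) x :=
  ∑ i, tangentSingle x i (tangentProj x i (g.grad (lam i) x))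

theorem contMDiff_blockGradient (hlam : ∀ i, ContMDiff (piModel E) 𝓘(ℝ, ℝ) ∞ (lam i)) :
    ContMDiff (piModel E) (piModel E).tangent ∞
      (fun x ↦ (⟨x, blockGradient g lam x⟩ : TangentBundle (piModel E) (∀ i, M i))) := by
  intro x
  rw [contMDiffAt_vectorField_iff]
  refine ContMDiffAt.congr_of_eventuallyEq (contMDiffAt_finsetSum (t := Finset.univ) fun i _ ↦
    g.contMDiffAt_single_gradCoord (hlam i x) i) ?_
  filter_upwards [chart_source_mem_nhds (ModelPi E) x] with y hy
  rw [blockGradient, map_sum]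
  refine Finset.sum_congr rfl fun i _ ↦ ?_
  rw [← g.chartFrame_single_gradCoord hy, chartCoframe_chartFrame hy]

theorem inner_blockGradient (hg : g.IsBlockDiagonal)
    (hlam : ∀ i, ContMDiff (piModel E) 𝓘(ℝ, ℝ) ∞ (lam i)) (x : ∀ i, M i)
    (X : TangentSpace (piModel E) x) :
    g.inner x X (blockGradient g lam x) = ∑ i, partialDeriv E i (lam i) x (tangentProj x i X) := by
  rw [blockGradient, map_sum]
  refine Finset.sum_congr rfl fun i _ ↦ ?_
  rw [← mvfderiv_tangentSingle ((hlam i x).mdifferentiableAt (by simp)), ← g.inner_grad,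
    g.symm x X, hg.inner_tangentSingle_left x i _ X, g.symm x (g.grad (lam i) x),
    hg.inner_tangentSingle_left x i _ (g.grad (lam i) x), g.symm]

theorem bracketForm_eq_of_blockScaling (hg : g.IsBlockDiagonal)
    (hlam : ∀ i, ContMDiff (piModel E) 𝓘(ℝ, ℝ) ∞ (lam i)) (h : BlockScaling g lam)
    (x : ∀ i, M i) (X : TangentSpace (piModel E) x) :
    bracketForm g lam x X = g.inner x X (blockGradient g lam x) * g.inner x X X := by
  rw [bracketForm, inner_blockGradient hg hlam, hg.inner_eq_sum x X X, Finset.sum_mul_sum]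
  refine Finset.sum_congr rfl fun i _ ↦ Finset.sum_congr rfl fun j _ ↦ ?_
  change _ = _ * g.blockQuad j _ x
  rw [bracketTerm]
  obtain rfl | hij := eq_or_ne i j
  · ring
  · have hlam' (i : ι) := (hlam i x).mdifferentiableAt (by simp)
    have hscale := DFunLike.congr_fun (h x i j hij (tangentProj x j X)) (tangentProj x i X)
    rw [partialDeriv_sub (hlam' i) (hlam' j)] at hscale
    simp only [smul_apply, sub_apply, smul_eq_mul] at hscale
    linarith

theorem isConformalKilling_iff_blockScaling [Nonempty (∀ i, M i)]
    {T : (x : ∀ i, M i) → TangentSpace (piModel E) x →L[ℝ] TangentSpace (piModel E) x}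
    (hT : IsOrthogonalTensor g T) (hadapted : IsAdaptedToEigenspaces T lam) :
    IsConformalKilling g T ↔ BlockScaling g lam := by
  have hg := hadapted.isBlockDiagonal hT
  have hlam := hadapted.contMDiff_lam hT
  have := hadapted.nontrivial
  rw [isConformalKilling_iff_bracketForm hT hadapted]
  constructor
  · rintro ⟨C, -, hC⟩
    exact blockScaling_of_bracketForm_eq hg hlam hC
  · intro h
    exact ⟨blockGradient g lam, contMDiff_blockGradient hlam,
      bracketForm_eq_of_blockScaling hg hlam h⟩

end KillingEquation

section Constancy

variable {E : Type*} [NormedAddCommGroup E] [NormedSpace ℝ E]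
  {H : Type*} [TopologicalSpace H] {I : ModelWithCorners ℝ E H} [I.Boundaryless]
  {M : Type*} [TopologicalSpace M] [ChartedSpace H M] [IsManifold I ∞ M]

theorem isLocallyConstant_of_mvfderiv_eq_zero {F : Type*} [NormedAddCommGroup F] [NormedSpace ℝ F]
    {f : M → F} (hf : MDifferentiable I 𝓘(ℝ, F) f) (h : ∀ x, mvfderiv I f x = 0) :
    IsLocallyConstant f := by
  rw [IsLocallyConstant.iff_eventually_eq]
  intro x
  let φ := extChartAt I x
  have hdiff : DifferentiableOn ℝ (f ∘ φ.symm) φ.target := fun z hz ↦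
    ((hf _).comp z (mdifferentiableAt_extChartAt_symm hz)).differentiableAt.differentiableWithinAt
  have hzero : φ.target.EqOn (fderiv ℝ (f ∘ φ.symm)) 0 := by
    intro z hz
    ext v
    have hframe := mvfderiv_chartFrame (x₀ := x) (y := φ.symm z)
      (by simpa [φ] using φ.map_target hz) (hf _) v
    rw [h, show extChartAt I x (φ.symm z) = z from φ.right_inv hz] at hframe
    exact hframe.symm
  have hopen := (isOpen_extChartAt_target x).isOpen_inter_preimage_of_fderiv_eq_zero hdiff hzero
    {f x}
  have hx : φ x ∈ φ.target ∩ (f ∘ φ.symm) ⁻¹' {f x} :=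
    ⟨mem_extChartAt_target x, congrArg f (extChartAt_to_inv x)⟩
  filter_upwards [extChartAt_source_mem_nhds (I := I) x,
    (continuousAt_extChartAt (I := I) x).preimage_mem_nhds (hopen.mem_nhds hx)] with y hy hconst
  exact (congrArg f (φ.left_inv hy)).symm.trans hconst.2

theorem div_eq_div_of_smul_mvfderiv_eq [PreconnectedSpace M] {F D : M → ℝ}
    (hF : MDifferentiable I 𝓘(ℝ, ℝ) F) (hD : MDifferentiable I 𝓘(ℝ, ℝ) D) (hD₀ : ∀ x, D x ≠ 0)
    (h : ∀ x, D x • mvfderiv I F x = F x • mvfderiv I D x) (x y : M) : F x / D x = F y / D y := by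
  have hquot : MDifferentiable I 𝓘(ℝ, ℝ) (fun x ↦ F x / D x) := hF.div hD hD₀
  refine (isLocallyConstant_of_mvfderiv_eq_zero hquot fun x ↦ ?_).apply_eq_of_preconnectedSpace x y
  have hprod := mvfderiv_fun_mul (hD x) (hquot x)
  simp only [mul_div_cancel₀ _ (hD₀ _)] at hprod
  have hscaled := h x
  rw [hprod, smul_add, smul_smul (D x) (F x / D x), mul_div_cancel₀ _ (hD₀ x), add_eq_right,
    smul_eq_zero_iff_right (hD₀ x), smul_eq_zero_iff_right (hD₀ x)] at hscaled
  exact hscaled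

end Constancy

section Twisted

variable {ι : Type*} [Fintype ι] [DecidableEq ι] {E : ι → Type*} [∀ i, NormedAddCommGroup (E i)]
  [∀ i, NormedSpace ℝ (E i)] {M : ι → Type*} [∀ i, TopologicalSpace (M i)]
  [∀ i, ChartedSpace (E i) (M i)]

theorem mul_mvfderiv_log_abs {f : (∀ i, M i) → ℝ} {x : ∀ i, M i}
    (hf : MDifferentiableAt (piModel E) 𝓘(ℝ, ℝ) f x) (hx : f x ≠ 0) (i : ι) (a : E i) :
    f x * mvfderiv (piModel E) (fun y ↦ Real.log |f y|) x (tangentSingle x i a) =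
      partialDeriv E i f x a := by
  simp only [Real.log_abs]
  rw [mvfderiv_log hf hx, smul_apply, smul_eq_mul, mul_inv_cancel_left₀ hx,
    mvfderiv_tangentSingle hf]

variable [∀ i, IsManifold 𝓘(ℝ, E i) ∞ (M i)]
  {g : PseudoRiemannianMetric (piModel E) (∀ i, M i)}
  {gf : (i : ι) → PseudoRiemannianMetric 𝓘(ℝ, E i) (M i)} {ρ lam : ι → (∀ i, M i) → ℝ}

theorem IsTwistedProductMetric.blockQuad_eq (h : IsTwistedProductMetric g gf ρ) (j : ι) (v : E j)
    (x : ∀ i, M i) : g.blockQuad j v x = ρ j x ^ 2 * (gf j).inner (x j) v v := by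
  rw [PseudoRiemannianMetric.blockQuad, h.inner_eq, Finset.sum_eq_single j]
  · simp only [mfderiv_apply_pi, tangentProj_tangentSingle_self]
  · intro k _ hk
    rw [mfderiv_apply_pi, tangentProj_tangentSingle_of_ne x hk]
    exact mul_eq_zero_of_right _ (congrArg (fun L : E k →L[ℝ] ℝ ↦ L _) (map_zero _))
  · simp

theorem IsTwistedProductMetric.partialDeriv_blockQuad (h : IsTwistedProductMetric g gf ρ)
    {i j : ι} (hij : i ≠ j) (v : E j) (x : ∀ i, M i) (a : E i) :
    partialDeriv E i (g.blockQuad j v) x a =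
      2 * mvfderiv (piModel E) (fun y ↦ Real.log (ρ j y)) x (tangentSingle x i a) *
        g.blockQuad j v x := by
  let c : ℝ := (gf j).inner (x j) v v
  have hρ : MDifferentiableAt (piModel E) 𝓘(ℝ, ℝ) (ρ j) x :=
    (h.contMDiff j).mdifferentiableAt (by simp)
  have hρ₀ : ρ j x ≠ 0 := (h.pos j x).ne'
  have hsq : MDifferentiableAt (piModel E) 𝓘(ℝ, ℝ) (fun y ↦ ρ j y * ρ j y) x := hρ.mul hρ
  have hsqc : MDifferentiableAt (piModel E) 𝓘(ℝ, ℝ) (fun y ↦ ρ j y * ρ j y * c) x :=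
    hsq.mul mdifferentiableAt_const
  have hslice (y : M i) : g.blockQuad j v (Function.update x i y) =
      ρ j (Function.update x i y) * ρ j (Function.update x i y) * c := by
    have hbase (z : M j) (hz : z = x j) : (gf j).inner z v v = c := by
      subst hz
      rfl
    rw [h.blockQuad_eq, ← sq]
    exact congrArg _ (hbase _ (Function.update_of_ne hij.symm _ _))
  have hpartial : partialDeriv E i (g.blockQuad j v) x =
      partialDeriv E i (fun y ↦ ρ j y * ρ j y * c) x :=
    congrArg (fun F : M i → ℝ ↦ mvfderiv 𝓘(ℝ, E i) F (x i)) (funext hslice)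
  rw [hpartial, ← mvfderiv_tangentSingle hsqc, mvfderiv_fun_mul hsq mdifferentiableAt_const,
    mvfderiv_const, mvfderiv_fun_mul hρ hρ, mvfderiv_log hρ hρ₀, h.blockQuad_eq]
  simp only [smul_zero, zero_add, smul_apply, add_apply, smul_eq_mul]
  change c * _ = _ * (ρ j x ^ 2 * c)
  field_simp
  ring

theorem IsTwistedProductMetric.blockScaling_iff [∀ i, Nontrivial (E i)] (hg : g.IsBlockDiagonal)
    (h : IsTwistedProductMetric g gf ρ) (hlam : ∀ i, ContMDiff (piModel E) 𝓘(ℝ, ℝ) ∞ (lam i))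
    (hne : ∀ x i j, i ≠ j → lam i x ≠ lam j x) :
    BlockScaling g lam ↔ ∀ i x j, j ≠ i → ∀ v : E j,
      mvfderiv (piModel E) (fun y ↦ Real.log (ρ i y)) x (tangentSingle x j v) =
        1 / 2 * mvfderiv (piModel E) (fun y ↦ Real.log |lam i y - lam j y|) x
          (tangentSingle x j v) := by
  have hsub (x : ∀ i, M i) {i j : ι} (hij : i ≠ j) : lam i x - lam j x ≠ 0 :=
    sub_ne_zero.2 (hne x i j hij)
  have hlogDeriv (x : ∀ i, M i) {i j : ι} (hij : i ≠ j) (a : E i) :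
      (lam i x - lam j x) * mvfderiv (piModel E) (fun y ↦ Real.log |lam j y - lam i y|) x
        (tangentSingle x i a) = partialDeriv E i (fun y ↦ lam i y - lam j y) x a := by
    rw [funext fun y ↦ congrArg Real.log (abs_sub_comm (lam j y) (lam i y))]
    exact mul_mvfderiv_log_abs (((hlam i).sub (hlam j)).mdifferentiableAt (by simp))
      (hsub x hij) i a
  constructor
  · intro hs i x j hji a
    obtain ⟨v, hv⟩ := hg.exists_inner_self_ne_zero (i := i) x
    have hscaling := DFunLike.congr_fun (hs x j i hji v) a
    rw [smul_apply, smul_apply, h.partialDeriv_blockQuad hji,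
      ← hlogDeriv x hji] at hscaling
    simp only [smul_eq_mul] at hscaling
    refine mul_left_cancel₀ (mul_ne_zero (hsub x hji) hv) ?_
    change _ * g.blockQuad i v x * _ = _ * g.blockQuad i v x * _
    linear_combination (1 / 2) * hscaling
  · intro hlog x i j hij v
    ext a
    rw [smul_apply, smul_apply, h.partialDeriv_blockQuad hij, hlog j x i hij,
      ← hlogDeriv x hij]
    simp only [smul_eq_mul]
    ring

theorem BlockScaling.blockQuad_eq_div_mul (h : BlockScaling g lam)
    (hlam : ∀ i, ContMDiff (piModel E) 𝓘(ℝ, ℝ) ∞ (lam i)) {i j : ι} (hij : i ≠ j)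
    (hne : ∀ x, lam i x ≠ lam j x) [PreconnectedSpace (M i)] (x : ∀ i, M i) (z : M i) (v : E j) :
    g.blockQuad j v x =
      (lam i x - lam j x) / (lam i (Function.update x i z) - lam j (Function.update x i z)) *
        g.blockQuad j v (Function.update x i z) := by
  let F : M i → ℝ := fun y ↦ g.blockQuad j v (Function.update x i y)
  let D : M i → ℝ := fun y ↦ lam i (Function.update x i y) - lam j (Function.update x i y)
  have hF : MDifferentiable 𝓘(ℝ, E i) 𝓘(ℝ, ℝ) F :=
    (g.contMDiff_blockQuad_update x hij v).mdifferentiable (by simp)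
  have hD : MDifferentiable 𝓘(ℝ, E i) 𝓘(ℝ, ℝ) D :=
    (((hlam i).sub (hlam j)).comp (contMDiff_update x i)).mdifferentiable (by simp)
  have hD₀ (y : M i) : D y ≠ 0 := sub_ne_zero.2 (hne _)
  have hlogDeriv (y : M i) :
      D y • mvfderiv 𝓘(ℝ, E i) F y = F y • mvfderiv 𝓘(ℝ, E i) D y := by
    ext a
    have hscaling := DFunLike.congr_fun (h (Function.update x i y) i j hij v) (show E i from a)
    rw [smul_apply, smul_apply, partialDeriv_update, partialDeriv_update] at hscaling
    exact hscaling
  have hconst := div_eq_div_of_smul_mvfderiv_eq hF hD hD₀ hlogDeriv (x i) z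
  have hx : F (x i) / D (x i) = g.blockQuad j v x / (lam i x - lam j x) := by
    simp only [F, D, Function.update_eq_self]
  rw [hx, div_eq_iff (sub_ne_zero.2 (hne x))] at hconst
  rw [hconst]
  ring

end Twisted

section Construction

theorem div_pos_of_continuous_of_ne_zero {X 𝕜 : Type*} [TopologicalSpace X] [PreconnectedSpace X]
    [Field 𝕜] [LinearOrder 𝕜] [IsStrictOrderedRing 𝕜] [TopologicalSpace 𝕜] [OrderClosedTopology 𝕜]
    {f : X → 𝕜} (hf : Continuous f) (hf₀ : ∀ x, f x ≠ 0) (x y : X) : 0 < f x / f y := by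
  have hsign {x y : X} (hx : f x < 0) (hy : 0 < f y) : False := by
    obtain ⟨z, hz⟩ := mem_range_of_exists_le_of_exists_ge hf ⟨x, hx.le⟩ ⟨y, hy.le⟩
    exact hf₀ z hz
  rcases (hf₀ x).lt_or_gt with hx | hx <;> rcases (hf₀ y).lt_or_gt with hy | hy
  · exact div_pos_of_neg_of_neg hx hy
  · exact (hsign hx hy).elim
  · exact (hsign hy hx).elim
  · exact div_pos hx hy

theorem preconnectedSpace_of_pi {ι : Type*} {X : ι → Type*} [∀ i, TopologicalSpace (X i)]
    [ConnectedSpace (∀ i, X i)] (i : ι) : PreconnectedSpace (X i) := by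
  have hX (i : ι) : Nonempty (X i) := (inferInstance : Nonempty (∀ i, X i)).map fun x ↦ x i
  exact (Function.surjective_eval i).denseRange.preconnectedSpace (continuous_apply i)

variable {ι : Type*} [Fintype ι] [DecidableEq ι] {E : ι → Type*} [∀ i, NormedAddCommGroup (E i)]
  [∀ i, NormedSpace ℝ (E i)] {M : ι → Type*} [∀ i, TopologicalSpace (M i)]
  [∀ i, ChartedSpace (E i) (M i)]

theorem contMDiff_piecewise {n : WithTop ℕ∞} (x₀ : ∀ i, M i) (S : Finset ι) :
    ContMDiff (piModel E) (piModel E) n (fun x : ∀ i, M i ↦ S.piecewise x₀ x) := by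
  rw [contMDiff_pi_iff]
  intro j
  by_cases h : j ∈ S
  · simpa [h] using contMDiff_const
  · simpa [h] using contMDiff_apply_pi j

variable [∀ i, IsManifold 𝓘(ℝ, E i) ∞ (M i)]
  {g : PseudoRiemannianMetric (piModel E) (∀ i, M i)} {lam : ι → (∀ i, M i) → ℝ}

namespace PseudoRiemannianMetric

/-- The restriction of a metric on the product to the slice of the `j`-th factor through `x₀`. -/
def sliceInner (g : PseudoRiemannianMetric (piModel E) (∀ i, M i)) (x₀ : ∀ i, M i) (j : ι)
    (z : M j) : TangentSpace 𝓘(ℝ, E j) z →L[ℝ] TangentSpace 𝓘(ℝ, E j) z →L[ℝ] ℝ :=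
  (show E j →L[ℝ] E j →L[ℝ] ℝ from
    (show (∀ i, E i) →L[ℝ] (∀ i, E i) →L[ℝ] ℝ from g.inner (Function.update x₀ j z)).bilinearComp
      (ContinuousLinearMap.single ℝ E j) (ContinuousLinearMap.single ℝ E j))

theorem bilinCoord_sliceInner (g : PseudoRiemannianMetric (piModel E) (∀ i, M i))
    (x₀ : ∀ i, M i) {j : ι} {z₀ z : M j} (hz : z ∈ (chartAt (E j) z₀).source) :
    bilinCoord (g.sliceInner x₀ j) z₀ z =
      (g.coord (Function.update x₀ j z₀) (Function.update x₀ j z)).bilinearComp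
        (ContinuousLinearMap.single ℝ E j) (ContinuousLinearMap.single ℝ E j) := by
  have hsource : Function.update x₀ j z ∈
      (chartAt (ModelPi E) (Function.update x₀ j z₀)).source := by
    rw [← Function.update_idem z₀ z x₀]
    exact update_mem_chartAt_pi_source (by rwa [Function.update_self])
  have hframe (u : E j) : chartFrame (piModel E) (Function.update x₀ j z₀)
      (Function.update x₀ j z) (Pi.single j u) =
      tangentSingle (Function.update x₀ j z) j (chartFrame 𝓘(ℝ, E j) z₀ z u) := by
    rw [chartFrame_single hsource]
    congr 1
    rw [Function.update_self, Function.update_self]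
  ext v w
  change _ = g.coord (Function.update x₀ j z₀) (Function.update x₀ j z)
    (Pi.single j v) (Pi.single j w)
  rw [g.coord_apply, hframe, hframe]
  rfl

theorem contMDiff_sliceInner (g : PseudoRiemannianMetric (piModel E) (∀ i, M i))
    (x₀ : ∀ i, M i) (j : ι) :
    ContMDiff 𝓘(ℝ, E j) (𝓘(ℝ, E j).prod 𝓘(ℝ, E j →L[ℝ] E j →L[ℝ] ℝ)) ∞
      (fun z ↦ TotalSpace.mk' (E j →L[ℝ] E j →L[ℝ] ℝ) z (g.sliceInner x₀ j z)) := by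
  intro z₀
  refine contMDiffAt_bilin_iff.2 ?_
  let single := ContinuousLinearMap.single ℝ E j
  have hcoord : ContMDiffAt 𝓘(ℝ, E j) 𝓘(ℝ, (∀ i, E i) →L[ℝ] (∀ i, E i) →L[ℝ] ℝ) ∞
      (fun z ↦ g.coord (Function.update x₀ j z₀) (Function.update x₀ j z)) z₀ :=
    (g.contMDiffAt_coord (Function.update x₀ j z₀)).comp z₀ (contMDiff_update x₀ j z₀)
  have hcomp := (contMDiffAt_const
    (c := (ContinuousLinearMap.compL ℝ (E j) (∀ i, E i) ℝ).flip single)).clm_comp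
    (hcoord.clm_comp (contMDiffAt_const (c := single)))
  refine hcomp.congr_of_eventuallyEq ?_
  filter_upwards [chart_source_mem_nhds (E j) z₀] with z hz
  exact g.bilinCoord_sliceInner x₀ hz

/-- The metric induced by a block diagonal metric on the slice of the `j`-th factor through `x₀`. -/
def IsBlockDiagonal.slice (hg : g.IsBlockDiagonal) (x₀ : ∀ i, M i) (j : ι) :
    PseudoRiemannianMetric 𝓘(ℝ, E j) (M j) where
  inner := g.sliceInner x₀ j
  symm z v w := g.symm (Function.update x₀ j z) (tangentSingle _ j v) (tangentSingle _ j w)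
  nondegenerate z v h := hg.nondegenerate_block (Function.update x₀ j z) j v h
  contMDiff := g.contMDiff_sliceInner x₀ j

theorem IsBlockDiagonal.slice_inner (hg : g.IsBlockDiagonal) (x₀ : ∀ i, M i) (j : ι) (z : M j)
    (v w : E j) : (hg.slice x₀ j).inner z v w =
      g.inner (Function.update x₀ j z) (tangentSingle _ j v) (tangentSingle _ j w) := rfl

theorem inner_tangentSingle_eq_mul_of_blockQuad_eq_mul
    (g : PseudoRiemannianMetric (piModel E) (∀ i, M i)) {x y : ∀ i, M i} {j : ι} {c : ℝ}
    (h : ∀ v, g.blockQuad j v x = c * g.blockQuad j v y) (v w : E j) :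
    g.inner x (tangentSingle x j v) (tangentSingle x j w) =
      c * g.inner y (tangentSingle y j v) (tangentSingle y j w) := by
  have hsum := h (v + w)
  have hv := h v
  have hw := h w
  simp only [blockQuad, map_add, add_apply] at hsum hv hw
  rw [hv, hw, g.symm x (tangentSingle x j w) (tangentSingle x j v),
    g.symm y (tangentSingle y j w) (tangentSingle y j v)] at hsum
  linarith

end PseudoRiemannianMetric

namespace BlockScaling

theorem exists_blockQuad_eq_mul_piecewise [ConnectedSpace (∀ i, M i)] (h : BlockScaling g lam)
    (hlam : ∀ i, ContMDiff (piModel E) 𝓘(ℝ, ℝ) ∞ (lam i))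
    (hne : ∀ x i j, i ≠ j → lam i x ≠ lam j x) (x₀ : ∀ i, M i) {j : ι} {S : Finset ι}
    (hS : j ∉ S) :
    ∃ σ : (∀ i, M i) → ℝ, ContMDiff (piModel E) 𝓘(ℝ, ℝ) ∞ σ ∧ (∀ x, 0 < σ x) ∧
      ∀ x (v : E j), g.blockQuad j v x = σ x * g.blockQuad j v (S.piecewise x₀ x) := by
  induction S using Finset.induction_on with
  | empty => exact ⟨fun _ ↦ 1, contMDiff_const, fun _ ↦ one_pos, fun x v ↦ by simp⟩
  | insert i S _ ih =>
    rw [Finset.mem_insert, not_or] at hS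
    obtain ⟨hji, hjS⟩ := hS
    have hij : i ≠ j := Ne.symm hji
    obtain ⟨σ, hσ, hpos, hquad⟩ := ih hjS
    let D : (∀ i, M i) → ℝ := fun x ↦ lam i x - lam j x
    have hD : ContMDiff (piModel E) 𝓘(ℝ, ℝ) ∞ D := (hlam i).sub (hlam j)
    have hD₀ (y : ∀ i, M i) : D y ≠ 0 := sub_ne_zero.2 (hne y i j hij)
    have hratio : ContMDiff (piModel E) 𝓘(ℝ, ℝ) ∞
        (fun x ↦ D x / D (Function.update x i (x₀ i))) :=
      hD.div₀ (hD.comp (contMDiff_update_const i (x₀ i))) fun x ↦ hD₀ _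
    refine ⟨fun x ↦ σ x * (D (S.piecewise x₀ x) /
        D (Function.update (S.piecewise x₀ x) i (x₀ i))),
      hσ.mul (hratio.comp (contMDiff_piecewise x₀ S)),
      fun x ↦ mul_pos (hpos x) (div_pos_of_continuous_of_ne_zero hD.continuous hD₀ _ _),
      fun x v ↦ ?_⟩
    have := preconnectedSpace_of_pi (X := M) i
    rw [hquad, S.piecewise_insert, mul_assoc, h.blockQuad_eq_div_mul hlam hij
      (fun y ↦ hne y i j hij) (S.piecewise x₀ x) (x₀ i) v]

theorem exists_isTwistedProductMetric [ConnectedSpace (∀ i, M i)] (hg : g.IsBlockDiagonal)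
    (h : BlockScaling g lam) (hlam : ∀ i, ContMDiff (piModel E) 𝓘(ℝ, ℝ) ∞ (lam i))
    (hne : ∀ x i j, i ≠ j → lam i x ≠ lam j x) :
    ∃ (gf : (i : ι) → PseudoRiemannianMetric 𝓘(ℝ, E i) (M i)) (ρ : ι → (∀ i, M i) → ℝ),
      IsTwistedProductMetric g gf ρ := by
  obtain ⟨x₀⟩ := (inferInstance : Nonempty (∀ i, M i))
  choose σ hσ hpos hquad using fun j ↦
    h.exists_blockQuad_eq_mul_piecewise hlam hne x₀ (Finset.notMem_erase j Finset.univ)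
  have hslice (j : ι) (x : ∀ i, M i) (v : E j) :
      g.blockQuad j v x = σ j x * g.blockQuad j v (Function.update x₀ j (x j)) := by
    rw [hquad, Finset.piecewise_erase_univ]
  refine ⟨hg.slice x₀, fun j x ↦ √(σ j x), fun j x ↦ ?_, fun j x ↦ Real.sqrt_pos.2 (hpos j x),
    fun x v w ↦ ?_⟩
  · exact (Real.contDiffAt_sqrt (hpos j x).ne').contMDiffAt.comp x (hσ j x)
  · rw [hg.inner_eq_sum]
    refine Finset.sum_congr rfl fun j _ ↦ ?_
    rw [Real.sq_sqrt (hpos j x).le, mfderiv_apply_pi, mfderiv_apply_pi, hg.slice_inner]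
    exact g.inner_tangentSingle_eq_mul_of_blockQuad_eq_mul (hslice j x) _ _

end BlockScaling

end Construction

end

theorem mainTheorem4 {ι : Type*} [Fintype ι] [DecidableEq ι]
    {E : ι → Type*} [∀ i, NormedAddCommGroup (E i)] [∀ i, NormedSpace ℝ (E i)]
    [∀ i, FiniteDimensional ℝ (E i)]
    {M : ι → Type*} [∀ i, TopologicalSpace (M i)] [∀ i, ChartedSpace (E i) (M i)]
    [∀ i, IsManifold 𝓘(ℝ, E i) ∞ (M i)] [ConnectedSpace (∀ i, M i)]
    (g : PseudoRiemannianMetric (piModel E) (∀ i, M i))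
    (T : (x : ∀ i, M i) → TangentSpace (piModel E) x →L[ℝ] TangentSpace (piModel E) x)
    (hT : IsOrthogonalTensor g T)
    (lam : ι → (∀ i, M i) → ℝ) (hadapted : IsAdaptedToEigenspaces T lam) :
    IsConformalKilling g T ↔
      ∃ (gf : (i : ι) → PseudoRiemannianMetric 𝓘(ℝ, E i) (M i)) (ρ : ι → (∀ i, M i) → ℝ),
        IsTwistedProductMetric g gf ρ ∧
        ∀ (i : ι) (x : ∀ i, M i),
          g.perpProj x (productNet i x) (g.grad (fun y ↦ Real.log (ρ i y)) x) =
            (1 / 2 : ℝ) • ∑ j ∈ Finset.univ.erase i,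
              g.orthProj x (productNet j x)
                (g.grad (fun y ↦ Real.log |lam i y - lam j y|) x) := by
  have hg := hadapted.isBlockDiagonal hT
  have := hadapted.nontrivial
  have hlam := hadapted.contMDiff_lam hT
  have hne : ∀ x i j, i ≠ j → lam i x ≠ lam j x := fun x i j hij ↦ hadapted.lam_ne x hij
  rw [isConformalKilling_iff_blockScaling hT hadapted]
  have hiff : ∀ gf ρ, IsTwistedProductMetric g gf ρ → (BlockScaling g lam ↔ _) :=
    fun gf ρ h ↦ (h.blockScaling_iff hg hlam hne).trans (forall₂_congr fun i x ↦
      (hg.perpProj_grad_eq_iff x i (1 / 2) (fun y ↦ Real.log (ρ i y))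
        (fun j y ↦ Real.log |lam i y - lam j y|)).symm)
  constructor
  · intro h
    obtain ⟨gf, ρ, hρ⟩ := h.exists_isTwistedProductMetric hg hlam hne
    exact ⟨gf, ρ, hρ, (hiff gf ρ hρ).1 h⟩
  · rintro ⟨gf, ρ, hρ, hgrad⟩
    exact (hiff gf ρ hρ).2 hgrad
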